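/- Let $\mathbb{Z}^*=\mathbb{Z}\setminus\{0\}$, $I=\begin{pmatrix}0&1\\1&0\end{pmatrix}$, $J=\begin{pmatrix}0&1\\-1&0\end{pmatrix}$. Let $B(\infty,\infty)$ be the set of complex matrices $X$ with rows and columns indexed by $\mathbb{Z}$ and only finitely many nonzero entries that satisfy the following conditions. Divide $X$ into blocks $X_{ij}$ ($i,j\in\mathbb{Z}$), where the block index $i>0$ comprises the row (column) numbers $2i-1,2i$, the block index $-i<0$ comprises $-2i,-2i+1$, and the block index $0$ comprises $0$; then $X_{00}=0$ and, for all $i,j\geq 1$, $$I X_{-i,-j}+X_{-j,-i}^T I=0,\quad J X_{i,j}+X_{j,i}^T J=0,\quad I X_{-i,j}-X_{j,-i}^T J=0,$$ $$X_{0,-j}+X_{-j,0}^T I=0,\quad X_{0,j}-X_{j,0}^T J=0.$$ The matrix $X$ is even if its entries in positions $(k,l)$ with $k\le 0<l$ or $l\le 0<k$ vanish, and odd if its entries in positions $(k,l)$ with $k,l\le 0$ or $k,l>0$ vanish. With the bracket $[\![X,Y]\!]=XY-(-1)^{\deg X\deg Y}YX$ for homogeneous $X,Y$, extended bilinearly,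 $B(\infty,\infty)$ is a complex Lie superalgebra. With $e_{kl}$ the matrix units, put for $i\ge 1$ $$c_{-i}^+=\sqrt2\,(e_{-2i,0}-e_{0,-2i+1}),\quad c_{-i}^-=\sqrt2\,(e_{0,-2i}-e_{-2i+1,0}),\quad c_i^+=\sqrt2\,(e_{0,2i}+e_{2i-1,0}),\quad c_i^-=\sqrt2\,(e_{0,2i-1}-e_{2i,0}),$$ and let $\langle i\rangle=0$ for $i<0$ and $\langle i\rangle=1$ for $i>0$; $c_i^\pm$ is homogeneous of degree $\langle i\rangle$. **Theorem.** As a Lie superalgebra defined by generators and relations, $B(\infty,\infty)$ is generated by the elements $c_i^\pm$ ($i\in\mathbb{Z}^*$), of degree $\langle i\rangle$, subject to the relations $$[\![[\![c_j^\xi,c_k^\eta]\!],c_l^\epsilon]\!]=-2\,\delta_{jl}\,\delta_{\epsilon,-\xi}\,\epsilon^{\langle l\rangle}(-1)^{\langle k\rangle\langle l\rangle}\,c_k^\eta+2\,\epsilon^{\langle l\rangle}\,\delta_{kl}\,\delta_{\epsilon,-\eta}\,c_j^\xi\qquad(j,k,l\in\mathbb{Z}^*,\ \xi,\eta,\epsilon\in\{+1,-1\}).$$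 That is, the matrices $c_i^\pm$ satisfy these relations and generate $B(\infty,\infty)$, and the unique Lie superalgebra homomorphism to $B(\infty,\infty)$ from the complex Lie superalgebra presented by these generators and relations, sending each generator to the matrix of the same name, is an isomorphism. -/

import Mathlib

open scoped Matrix

noncomputable section

/-! ## Lie superalgebras over the complex numbers -/

/-- The sign `(-1) ^ (a * b)` attached to two parities. -/
def superSign (a b : ZMod 2) : ℂ := (-1) ^ (a.val * b.val)

/-- A complex Lie superalgebra: a vector space that is the direct sum of its even part `grade 0` and
its odd part `grade 1`, with a bilinear bracket that respects the grading, is super skew-symmetric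
and satisfies the super Jacobi identity. -/
class LieSuperalgebra (L : Type*) [AddCommGroup L] [Module ℂ L] where
  /-- the homogeneous components -/
  grade : ZMod 2 → Submodule ℂ L
  /-- the bilinear superbracket -/
  sbr : L →ₗ[ℂ] L →ₗ[ℂ] L
  isCompl : IsCompl (grade 0) (grade 1)
  sbr_mem : ∀ {a b : ZMod 2} {x y : L}, x ∈ grade a → y ∈ grade b → sbr x y ∈ grade (a + b)
  skew : ∀ {a b : ZMod 2} {x y : L}, x ∈ grade a → y ∈ grade b →
    sbr x y = -(superSign a b • sbr y x)
  jacobi : ∀ {a b c : ZMod 2} {x y z : L}, x ∈ grade a → y ∈ grade b → z ∈ grade c →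
    sbr x (sbr y z) = sbr (sbr x y) z + superSign a b • sbr y (sbr x z)

/-- The superbracket of a Lie superalgebra. -/
abbrev sbr {L : Type*} [AddCommGroup L] [Module ℂ L] [LieSuperalgebra L] (x y : L) : L :=
  LieSuperalgebra.sbr x y

/-- Homomorphisms of Lie superalgebras: linear maps preserving parity and brackets. -/
structure LieSuperHom (L M : Type*) [AddCommGroup L] [Module ℂ L] [LieSuperalgebra L]
    [AddCommGroup M] [Module ℂ M] [LieSuperalgebra M] extends L →ₗ[ℂ] M where
  map_grade : ∀ (a : ZMod 2) (x : L), x ∈ LieSuperalgebra.grade a →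
    toLinearMap x ∈ (LieSuperalgebra.grade a : Submodule ℂ M)
  map_sbr : ∀ x y : L, toLinearMap (sbr x y) = sbr (toLinearMap x) (toLinearMap y)

/-! ## Lie superalgebras given by generators and relations -/

namespace FreeSuper

variable {X : Type*}

/-- The free non-associative algebra on `X`: its product plays the role of a formal bracket. -/
abbrev Free (X : Type*) : Type _ := FreeNonUnitalNonAssocAlgebra ℂ X

/-- The parity of a non-associative word in letters with given parities. -/
def wordParity (par : X → ZMod 2) : FreeMagma X → ZMod 2
  | FreeMagma.of x => par x
  | FreeMagma.mul u v => wordParity par u + wordParity par v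

/-- The homogeneous components of the free non-associative algebra: spans of words. -/
def grade (par : X → ZMod 2) (a : ZMod 2) : Submodule ℂ (Free X) :=
  Submodule.span ℂ {f | ∃ u : FreeMagma X, wordParity par u = a ∧ f = MonoidAlgebra.single u 1}

theorem of_mem_grade (par : X → ZMod 2) (x : X) :
    FreeNonUnitalNonAssocAlgebra.of ℂ x ∈ grade par (par x) :=
  Submodule.subset_span ⟨FreeMagma.of x, rfl, rfl⟩

theorem mul_mem_grade {par : X → ZMod 2} {a b : ZMod 2} {x y : Free X}
    (hx : x ∈ grade par a) (hy : y ∈ grade par b) : x * y ∈ grade par (a + b) := by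
  induction hx using Submodule.span_induction with
  | zero => simp
  | add x x' _ _ h h' => rw [add_mul]; exact add_mem h h'
  | smul c x _ h => rw [smul_mul_assoc]; exact Submodule.smul_mem _ _ h
  | mem x hx =>
    obtain ⟨u, hu, rfl⟩ := hx
    induction hy using Submodule.span_induction with
    | zero => simp
    | add y y' _ _ h h' => rw [mul_add]; exact add_mem h h'
    | smul c y _ h => rw [mul_smul_comm]; exact Submodule.smul_mem _ _ h
    | mem y hy =>
      obtain ⟨v, hv, rfl⟩ := hy
      refine Submodule.subset_span ⟨FreeMagma.mul u v, ?_, ?_⟩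
      · simp [wordParity, hu, hv]
      · rw [MonoidAlgebra.single_mul_single, one_mul]; rfl

theorem grade_sup (par : X → ZMod 2) : grade par 0 ⊔ grade par 1 = ⊤ := by
  rw [eq_top_iff]
  intro f _
  induction f using MonoidAlgebra.induction_linear with
  | zero => exact zero_mem _
  | add f g hf hg => exact add_mem (hf trivial) (hg trivial)
  | single u c =>
    have h : (MonoidAlgebra.single u c : Free X) = c • MonoidAlgebra.single u 1 := by
      simp [MonoidAlgebra.smul_single]
    rw [h]
    refine Submodule.smul_mem _ _ ?_
    have h2 : ∀ z : ZMod 2, z = 0 ∨ z = 1 := by decide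
    rcases h2 (wordParity par u) with h0 | h1
    · exact Submodule.mem_sup_left (Submodule.subset_span ⟨u, h0, rfl⟩)
    · exact Submodule.mem_sup_right (Submodule.subset_span ⟨u, h1, rfl⟩)

/-- The sign of a parity. -/
def sgn (a : ZMod 2) : ℂ := (-1) ^ a.val

theorem sgn_add (a b : ZMod 2) : sgn (a + b) = sgn a * sgn b := by
  revert a b
  have h2 : ∀ z : ZMod 2, z = 0 ∨ z = 1 := by decide
  intro a b
  have h11 : (1 + 1 : ZMod 2) = 0 := by decide
  rcases h2 a with rfl | rfl <;> rcases h2 b with rfl | rfl <;> simp [sgn, h11, ZMod.val_one]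

/-- The parity automorphism of the free non-associative algebra. -/
def theta (par : X → ZMod 2) : Free X →ₙₐ[ℂ] Free X :=
  FreeNonUnitalNonAssocAlgebra.lift ℂ
    (fun x => sgn (par x) • FreeNonUnitalNonAssocAlgebra.of ℂ x)

theorem theta_word (par : X → ZMod 2) (u : FreeMagma X) :
    theta par (MonoidAlgebra.single u 1) = sgn (wordParity par u) • MonoidAlgebra.single u 1 := by
  induction u with
  | ih1 x =>
    exact FreeNonUnitalNonAssocAlgebra.lift_of_apply ℂ
      (fun x => sgn (par x) • FreeNonUnitalNonAssocAlgebra.of ℂ x) x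
  | ih2 u v hu hv =>
    have h : (MonoidAlgebra.single (u * v) 1 : Free X)
        = MonoidAlgebra.single u 1 * MonoidAlgebra.single v 1 := by
      rw [MonoidAlgebra.single_mul_single, one_mul]
    have h' : wordParity par (u * v) = wordParity par u + wordParity par v := rfl
    rw [h, map_mul, hu, hv, smul_mul_smul_comm, h', sgn_add]

theorem theta_of_mem {par : X → ZMod 2} {a : ZMod 2} {x : Free X} (hx : x ∈ grade par a) :
    theta par x = sgn a • x := by
  induction hx using Submodule.span_induction with
  | zero => simp
  | add x x' _ _ h h' => rw [map_add, h, h', smul_add]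
  | smul c x _ h => rw [map_smul, h, smul_comm]
  | mem x hx =>
    obtain ⟨u, hu, rfl⟩ := hx
    rw [theta_word, hu]

/-- Membership in the two-sided ideal of the free non-associative algebra generated by the super
skew-symmetry relations, the super Jacobi relations and the given relators. -/
inductive InIdeal (par : X → ZMod 2) (R : Set (Free X)) : Free X → Prop
  | rel {r : Free X} (hr : r ∈ R) : InIdeal par R r
  | skew {a b : ZMod 2} {x y : Free X} (hx : x ∈ grade par a) (hy : y ∈ grade par b) :
      InIdeal par R (x * y + superSign a b • (y * x))
  | jacobi {a b c : ZMod 2} {x y z : Free X} (hx : x ∈ grade par a) (hy : y ∈ grade par b)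
      (hz : z ∈ grade par c) :
      InIdeal par R (x * (y * z) - ((x * y) * z + superSign a b • (y * (x * z))))
  | zero : InIdeal par R 0
  | add {x y : Free X} : InIdeal par R x → InIdeal par R y → InIdeal par R (x + y)
  | smul (c : ℂ) {x : Free X} : InIdeal par R x → InIdeal par R (c • x)
  | mul_left (z : Free X) {x : Free X} : InIdeal par R x → InIdeal par R (z * x)
  | mul_right {x : Free X} (z : Free X) : InIdeal par R x → InIdeal par R (x * z)

theorem InIdeal.theta {par : X → ZMod 2} {R : Set (Free X)}
    (hR : ∀ r ∈ R, ∃ a, r ∈ grade par a) {x : Free X} (hx : InIdeal par R x) :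
    InIdeal par R (theta par x) := by
  induction hx with
  | rel hr =>
    obtain ⟨a, ha⟩ := hR _ hr
    rw [theta_of_mem ha]; exact .smul _ (.rel hr)
  | @skew a b x y hx hy =>
    rw [theta_of_mem (a := a + b)]
    · exact .smul _ (.skew hx hy)
    · refine add_mem (mul_mem_grade hx hy) (Submodule.smul_mem _ _ ?_)
      rw [add_comm]; exact mul_mem_grade hy hx
  | @jacobi a b c x y z hx hy hz =>
    rw [theta_of_mem (a := a + b + c)]
    · exact .smul _ (.jacobi hx hy hz)
    · refine sub_mem ?_ (add_mem (mul_mem_grade (mul_mem_grade hx hy) hz)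
        (Submodule.smul_mem _ _ ?_))
      · rw [add_assoc]; exact mul_mem_grade hx (mul_mem_grade hy hz)
      · rw [add_comm a b, add_assoc]; exact mul_mem_grade hy (mul_mem_grade hx hz)
  | zero => rw [map_zero]; exact .zero
  | add _ _ h h' => rw [map_add]; exact .add h h'
  | smul c _ h => rw [map_smul]; exact .smul c h
  | mul_left z _ h => rw [map_mul]; exact .mul_left _ h
  | mul_right z _ h => rw [map_mul]; exact .mul_right _ h

end FreeSuper

/-- A presentation of a Lie superalgebra: generators with parities, and homogeneous relators, which
are elements of the free non-associative algebra (the product standing for the bracket). -/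
structure SuperPresentation (X : Type*) where
  parity : X → ZMod 2
  relators : Set (FreeSuper.Free X)
  homogeneous : ∀ r ∈ relators, ∃ a, r ∈ FreeSuper.grade parity a

namespace SuperPresentation

variable {X : Type*} (P : SuperPresentation X)

/-- The ideal of all consequences of the Lie superalgebra axioms and the relators. -/
def ideal : Submodule ℂ (FreeSuper.Free X) where
  carrier := {x | FreeSuper.InIdeal P.parity P.relators x}
  zero_mem' := .zero
  add_mem' := .add
  smul_mem' c _ := .smul c

/-- The Lie superalgebra defined by the generators and relations of the presentation `P`. -/
abbrev Algebra : Type _ := FreeSuper.Free X ⧸ P.ideal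

/-- The generators of the presented Lie superalgebra. -/
def gen (x : X) : P.Algebra := P.ideal.mkQ (FreeNonUnitalNonAssocAlgebra.of ℂ x)

/-- Bracketing with (the class of) an element of the free algebra. -/
def bracketAux (x : FreeSuper.Free X) : P.Algebra →ₗ[ℂ] P.Algebra :=
  P.ideal.mapQ P.ideal (LinearMap.mulLeft ℂ x) (fun _ hy => FreeSuper.InIdeal.mul_left x hy)

theorem bracketAux_mk (x y : FreeSuper.Free X) :
    P.bracketAux x (P.ideal.mkQ y) = P.ideal.mkQ (x * y) := rfl

/-- The bracket of the presented Lie superalgebra, induced by the product of the free algebra. -/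
def bracket : P.Algebra →ₗ[ℂ] P.Algebra →ₗ[ℂ] P.Algebra :=
  P.ideal.liftQ
    { toFun := P.bracketAux
      map_add' := fun x y => by
        refine LinearMap.ext fun z => ?_
        obtain ⟨z, rfl⟩ := P.ideal.mkQ_surjective z
        rw [LinearMap.add_apply, bracketAux_mk, bracketAux_mk, bracketAux_mk, add_mul, map_add]
      map_smul' := fun c x => by
        refine LinearMap.ext fun z => ?_
        obtain ⟨z, rfl⟩ := P.ideal.mkQ_surjective z
        rw [RingHom.id_apply, LinearMap.smul_apply, bracketAux_mk, bracketAux_mk, smul_mul_assoc,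
          map_smul] }
    (fun x hx => by
      rw [LinearMap.mem_ker]
      refine LinearMap.ext fun z => ?_
      obtain ⟨z, rfl⟩ := P.ideal.mkQ_surjective z
      exact (Submodule.Quotient.mk_eq_zero P.ideal).2 (FreeSuper.InIdeal.mul_right z hx))

theorem bracket_mk (x y : FreeSuper.Free X) :
    P.bracket (P.ideal.mkQ x) (P.ideal.mkQ y) = P.ideal.mkQ (x * y) := rfl

theorem mkQ_eq_of_inIdeal {x y : FreeSuper.Free X}
    (h : FreeSuper.InIdeal P.parity P.relators (x - y)) : P.ideal.mkQ x = P.ideal.mkQ y :=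
  (Submodule.Quotient.eq P.ideal).2 h

/-- The map induced by the parity automorphism. -/
def thetaQ : P.Algebra →ₗ[ℂ] P.Algebra :=
  P.ideal.mapQ P.ideal (FreeSuper.theta P.parity : FreeSuper.Free X →ₗ[ℂ] FreeSuper.Free X)
    (fun _ hx => FreeSuper.InIdeal.theta P.homogeneous hx)

theorem thetaQ_of_mem {a : ZMod 2} {x : P.Algebra}
    (hx : x ∈ (FreeSuper.grade P.parity a).map P.ideal.mkQ) :
    P.thetaQ x = FreeSuper.sgn a • x := by
  obtain ⟨x, hx, rfl⟩ := hx
  have h : P.thetaQ (P.ideal.mkQ x) = P.ideal.mkQ (FreeSuper.theta P.parity x) := rfl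
  rw [h, FreeSuper.theta_of_mem hx, map_smul]

instance : LieSuperalgebra P.Algebra where
  grade a := (FreeSuper.grade P.parity a).map P.ideal.mkQ
  sbr := P.bracket
  isCompl := by
    constructor
    · rw [Submodule.disjoint_def]
      intro x h0 h1
      have e0 := P.thetaQ_of_mem h0
      have e1 := P.thetaQ_of_mem h1
      rw [e0] at e1
      simp only [FreeSuper.sgn, ZMod.val_zero, pow_zero, one_smul, ZMod.val_one, pow_one,
        neg_smul] at e1
      have h2 : (2 : ℂ) • x = 0 := by rw [two_smul]; nth_rewrite 1 [e1]; exact neg_add_cancel x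
      exact (smul_eq_zero.1 h2).resolve_left two_ne_zero
    · rw [codisjoint_iff, ← Submodule.map_sup, FreeSuper.grade_sup, Submodule.map_top,
        Submodule.range_mkQ]
  sbr_mem := by
    rintro a b _ _ ⟨x, hx, rfl⟩ ⟨y, hy, rfl⟩
    exact ⟨x * y, FreeSuper.mul_mem_grade hx hy, rfl⟩
  skew := by
    rintro a b _ _ ⟨x, hx, rfl⟩ ⟨y, hy, rfl⟩
    rw [bracket_mk, bracket_mk, ← map_smul, ← map_neg]
    apply P.mkQ_eq_of_inIdeal
    rw [sub_neg_eq_add]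
    exact .skew hx hy
  jacobi := by
    rintro a b c _ _ _ ⟨x, hx, rfl⟩ ⟨y, hy, rfl⟩ ⟨z, hz, rfl⟩
    simp only [bracket_mk]
    rw [← map_smul, ← map_add]
    exact P.mkQ_eq_of_inIdeal (.jacobi hx hy hz)

end SuperPresentation

/-! ## Finitary matrices with rows and columns indexed by the integers -/

/-- The space of complex `ℤ × ℤ` matrices with only finitely many nonzero entries. -/
def finitary : Submodule ℂ (Matrix ℤ ℤ ℂ) where
  carrier := {X | {p : ℤ × ℤ | X p.1 p.2 ≠ 0}.Finite}
  zero_mem' := by simp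
  add_mem' {X Y} hX hY := by
    refine (Set.Finite.union hX hY).subset ?_
    rintro ⟨i, j⟩ h
    by_contra hn
    simp only [Set.mem_union, Set.mem_ofPred_eq, not_or, not_not] at hn
    simp [hn.1, hn.2] at h
  smul_mem' c X hX := by
    refine Set.Finite.subset hX ?_
    rintro ⟨i, j⟩ h hn
    simp [hn] at h

/-- Finitary matrices. -/
abbrev FinMat : Type := finitary

namespace FinMat

theorem exists_bound (X : FinMat) :
    ∃ s : Finset ℤ, ∀ i j, X.1 i j ≠ 0 → i ∈ s ∧ j ∈ s := by
  have hX : {p : ℤ × ℤ | X.1 p.1 p.2 ≠ 0}.Finite := X.2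
  classical
  refine ⟨hX.toFinset.image Prod.fst ∪ hX.toFinset.image Prod.snd, fun i j h => ?_⟩
  have hm : (i, j) ∈ hX.toFinset := by simpa using h
  exact ⟨Finset.mem_union_left _ (Finset.mem_image.2 ⟨_, hm, rfl⟩),
    Finset.mem_union_right _ (Finset.mem_image.2 ⟨_, hm, rfl⟩)⟩

theorem mem_finitary_of_bound {X : Matrix ℤ ℤ ℂ} (s : Finset ℤ)
    (h : ∀ i j, X i j ≠ 0 → i ∈ s ∧ j ∈ s) : X ∈ finitary := by
  refine (s ×ˢ s).finite_toSet.subset ?_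
  rintro ⟨i, j⟩ hij
  simpa using h i j hij

/-- The entries of the matrix product: in each entry only finitely many terms are nonzero. -/
def mulFun (X Y : Matrix ℤ ℤ ℂ) : Matrix ℤ ℤ ℂ := fun i k => ∑ᶠ j, X i j * Y j k

theorem mulFun_eq_left {X : Matrix ℤ ℤ ℂ} (Y : Matrix ℤ ℤ ℂ) {s : Finset ℤ}
    (h : ∀ i j, X i j ≠ 0 → j ∈ s) (i k : ℤ) : mulFun X Y i k = ∑ j ∈ s, X i j * Y j k := by
  refine finsum_eq_sum_of_support_subset _ fun j hj => ?_
  exact h i j (left_ne_zero_of_mul hj)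

theorem mulFun_eq_right (X : Matrix ℤ ℤ ℂ) {Y : Matrix ℤ ℤ ℂ} {s : Finset ℤ}
    (h : ∀ i j, Y i j ≠ 0 → i ∈ s) (i k : ℤ) : mulFun X Y i k = ∑ j ∈ s, X i j * Y j k := by
  refine finsum_eq_sum_of_support_subset _ fun j hj => ?_
  exact h j k (right_ne_zero_of_mul hj)

/-- Matrix multiplication of finitary matrices. -/
instance : Mul FinMat where
  mul X Y := ⟨mulFun X.1 Y.1, by
    obtain ⟨s, hs⟩ := exists_bound X
    obtain ⟨t, ht⟩ := exists_bound Y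
    classical
    refine mem_finitary_of_bound (s ∪ t) fun i k h => ?_
    rw [mulFun_eq_left _ (fun i j h => (hs i j h).2)] at h
    obtain ⟨j, -, hj⟩ := Finset.exists_ne_zero_of_sum_ne_zero h
    exact ⟨Finset.mem_union_left _ (hs i j (left_ne_zero_of_mul hj)).1,
      Finset.mem_union_right _ (ht j k (right_ne_zero_of_mul hj)).2⟩⟩

theorem mul_apply (X Y : FinMat) (i k : ℤ) : (X * Y).1 i k = ∑ᶠ j, X.1 i j * Y.1 j k := rfl

theorem mul_eq_left {X : FinMat} (Y : FinMat) {s : Finset ℤ}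
    (h : ∀ i j, X.1 i j ≠ 0 → i ∈ s ∧ j ∈ s) (i k : ℤ) :
    (X * Y).1 i k = ∑ j ∈ s, X.1 i j * Y.1 j k :=
  mulFun_eq_left _ (fun i j hij => (h i j hij).2) i k

theorem mul_eq_right (X : FinMat) {Y : FinMat} {s : Finset ℤ}
    (h : ∀ i j, Y.1 i j ≠ 0 → i ∈ s ∧ j ∈ s) (i k : ℤ) :
    (X * Y).1 i k = ∑ j ∈ s, X.1 i j * Y.1 j k :=
  mulFun_eq_right _ (fun i j hij => (h i j hij).1) i k

@[ext] theorem ext {X Y : FinMat} (h : ∀ i j, X.1 i j = Y.1 i j) : X = Y :=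
  Subtype.ext (funext fun i => funext fun j => h i j)

theorem add_apply (X Y : FinMat) (i j : ℤ) : (X + Y).1 i j = X.1 i j + Y.1 i j := rfl
theorem sub_apply (X Y : FinMat) (i j : ℤ) : (X - Y).1 i j = X.1 i j - Y.1 i j := rfl
theorem smul_apply (c : ℂ) (X : FinMat) (i j : ℤ) : (c • X).1 i j = c * X.1 i j := rfl
theorem zero_apply (i j : ℤ) : (0 : FinMat).1 i j = 0 := rfl

instance : NonUnitalRing FinMat where
  left_distrib X Y Z := by
    obtain ⟨s, hs⟩ := exists_bound X
    ext i k
    simp only [add_apply, mul_eq_left _ hs, mul_add, Finset.sum_add_distrib]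
  right_distrib X Y Z := by
    obtain ⟨s, hs⟩ := exists_bound Z
    ext i k
    simp only [add_apply, mul_eq_right _ hs, add_mul, Finset.sum_add_distrib]
  zero_mul X := by
    obtain ⟨s, hs⟩ := exists_bound X
    ext i k
    simp [mul_eq_right _ hs]
  mul_zero X := by
    obtain ⟨s, hs⟩ := exists_bound X
    ext i k
    simp [mul_eq_left _ hs]
  mul_assoc X Y Z := by
    obtain ⟨s, hs⟩ := exists_bound X
    obtain ⟨t, ht⟩ := exists_bound Z
    ext i k
    rw [mul_eq_right _ ht, mul_eq_left _ hs]
    simp only [mul_eq_left _ hs, mul_eq_right _ ht, Finset.sum_mul, Finset.mul_sum, mul_assoc]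
    exact Finset.sum_comm

instance : IsScalarTower ℂ FinMat FinMat where
  smul_assoc c X Y := by
    obtain ⟨s, hs⟩ := exists_bound Y
    ext i k
    simp only [smul_eq_mul, smul_apply, mul_eq_right _ hs, Finset.mul_sum, mul_assoc]

instance : SMulCommClass ℂ FinMat FinMat where
  smul_comm c X Y := by
    obtain ⟨s, hs⟩ := exists_bound X
    ext i k
    simp only [smul_eq_mul, smul_apply, mul_eq_left _ hs, Finset.mul_sum, mul_left_comm]

/-- The matrix unit `e_{ij}`. -/
def e (i j : ℤ) : FinMat := ⟨Matrix.single i j 1, by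
  refine mem_finitary_of_bound {i, j} fun k l h => ?_
  have : i = k ∧ j = l := by
    by_contra hn
    exact h (Matrix.single_apply_of_ne _ _ _ _ _ hn)
  simp [this.1, this.2]⟩

/-- The parity of a row or column index: the indices `≤ 0` are even and the indices `> 0` odd. -/
def idx (k : ℤ) : ZMod 2 := if 0 < k then 1 else 0

/-- Homogeneous matrices: for `a = 0` the entries with row and column on different sides of the
horizontal and vertical lines (between `0` and `1`) vanish, for `a = 1` those on the same side. -/
def homog (a : ZMod 2) : Submodule ℂ FinMat where
  carrier := {X | ∀ k l, idx k + idx l ≠ a → X.1 k l = 0}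
  zero_mem' _ _ _ := rfl
  add_mem' hX hY k l h := by rw [add_apply, hX k l h, hY k l h, add_zero]
  smul_mem' c X hX k l h := by rw [smul_apply, hX k l h, mul_zero]

/-- The homogeneous component of a matrix. -/
def part (a : ZMod 2) : FinMat →ₗ[ℂ] FinMat where
  toFun X := ⟨fun k l => if idx k + idx l = a then X.1 k l else 0, by
    obtain ⟨s, hs⟩ := exists_bound X
    refine mem_finitary_of_bound s fun i j h => hs i j fun h0 => h ?_
    simp [h0]⟩
  map_add' X Y := by
    ext i j
    simp only [add_apply]
    split_ifs <;> simp
  map_smul' c X := by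
    ext i j
    simp only [smul_apply, RingHom.id_apply]
    split_ifs <;> simp

theorem part_apply (a : ZMod 2) (X : FinMat) (k l : ℤ) :
    (part a X).1 k l = if idx k + idx l = a then X.1 k l else 0 := rfl

theorem part_mem (a : ZMod 2) (X : FinMat) : part a X ∈ homog a := fun k l h => by
  rw [part_apply, if_neg h]

theorem part_same {a : ZMod 2} {X : FinMat} (hX : X ∈ homog a) : part a X = X := by
  ext k l
  rw [part_apply]
  split_ifs with h
  · rfl
  · exact (hX k l h).symm

theorem part_ne {a b : ZMod 2} {X : FinMat} (hX : X ∈ homog a) (hab : b ≠ a) : part b X = 0 := by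
  ext k l
  rw [part_apply]
  split_ifs with h
  · exact hX k l (h ▸ hab)
  · rfl

theorem part_add_part (X : FinMat) : part 0 X + part 1 X = X := by
  have h2 : ∀ z : ZMod 2, z = 0 ∨ z = 1 := by decide
  ext k l
  rw [add_apply, part_apply, part_apply]
  rcases h2 (idx k + idx l) with h | h <;> simp [h]

/-- The product of the `a`-component of `X` and the `b`-component of `Y`, as a bilinear map. -/
def partMul (a b : ZMod 2) : FinMat →ₗ[ℂ] FinMat →ₗ[ℂ] FinMat :=
  (LinearMap.mul ℂ FinMat).compl₁₂ (part a) (part b)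

/-- The superbracket: `XY - (-1)^(deg X deg Y) YX` on homogeneous matrices, extended
bilinearly through the homogeneous components of the two arguments. -/
def superBracket : FinMat →ₗ[ℂ] FinMat →ₗ[ℂ] FinMat :=
  ∑ a : ZMod 2, ∑ b : ZMod 2, (partMul a b - superSign a b • (partMul b a).flip)

theorem superBracket_apply {a b : ZMod 2} {X Y : FinMat} (hX : X ∈ homog a) (hY : Y ∈ homog b) :
    superBracket X Y = X * Y - superSign a b • (Y * X) := by
  have h : ∀ c d : ZMod 2, (c, d) ≠ (a, b) →
      (partMul c d - superSign c d • (partMul d c).flip) X Y = 0 := by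
    intro c d hcd
    have : part c X = 0 ∨ part d Y = 0 := by
      by_cases hc : c = a
      · right
        exact part_ne hY fun hd => hcd (by rw [hc, hd])
      · exact Or.inl (part_ne hX hc)
    rcases this with h | h <;> simp [partMul, h]
  simp only [superBracket, LinearMap.sum_apply]
  rw [← Finset.sum_product', Finset.sum_eq_single (a, b) (fun p _ hp => h p.1 p.2 hp) (by simp)]
  simp [partMul, part_same hX, part_same hY]

theorem mul_mem_homog {a b : ZMod 2} {X Y : FinMat} (hX : X ∈ homog a) (hY : Y ∈ homog b) :
    X * Y ∈ homog (a + b) := by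
  intro i k h
  obtain ⟨s, hs⟩ := exists_bound X
  rw [mul_eq_left _ hs]
  refine Finset.sum_eq_zero fun j _ => ?_
  by_cases h1 : idx i + idx j = a
  · by_cases h2 : idx j + idx k = b
    · refine absurd ?_ h
      rw [← h1, ← h2]
      generalize idx i = x
      generalize idx j = y
      generalize idx k = z
      revert x y z
      decide
    · rw [hY j k h2, mul_zero]
  · rw [hX i j h1, zero_mul]

theorem superBracket_mem {a b : ZMod 2} {X Y : FinMat} (hX : X ∈ homog a) (hY : Y ∈ homog b) :
    superBracket X Y ∈ homog (a + b) := by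
  rw [superBracket_apply hX hY]
  refine sub_mem (mul_mem_homog hX hY) (Submodule.smul_mem _ _ ?_)
  rw [add_comm]
  exact mul_mem_homog hY hX

theorem superSign_comm (a b : ZMod 2) : superSign a b = superSign b a := by
  rw [superSign, superSign, mul_comm]

theorem superSign_mul_self (a b : ZMod 2) : superSign a b * superSign a b = 1 := by
  rw [superSign, ← mul_pow]; simp

theorem superSign_add_right (a b c : ZMod 2) :
    superSign a (b + c) = superSign a b * superSign a c := by
  have h2 : ∀ z : ZMod 2, z = 0 ∨ z = 1 := by decide
  have h11 : (1 + 1 : ZMod 2) = 0 := by decide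
  rcases h2 a with rfl | rfl <;> rcases h2 b with rfl | rfl <;> rcases h2 c with rfl | rfl <;>
    simp [superSign, h11, ZMod.val_one]

theorem superBracket_skew {a b : ZMod 2} {X Y : FinMat} (hX : X ∈ homog a) (hY : Y ∈ homog b) :
    superBracket X Y = -(superSign a b • superBracket Y X) := by
  rw [superBracket_apply hX hY, superBracket_apply hY hX, smul_sub, smul_smul,
    superSign_comm b a, superSign_mul_self, one_smul, neg_sub]

theorem superBracket_jacobi {a b c : ZMod 2} {X Y Z : FinMat} (hX : X ∈ homog a)
    (hY : Y ∈ homog b) (hZ : Z ∈ homog c) :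
    superBracket X (superBracket Y Z)
      = superBracket (superBracket X Y) Z + superSign a b • superBracket Y (superBracket X Z) := by
  rw [superBracket_apply hX (superBracket_mem hY hZ), superBracket_apply (superBracket_mem hX hY) hZ,
    superBracket_apply hY (superBracket_mem hX hZ), superBracket_apply hX hY,
    superBracket_apply hY hZ, superBracket_apply hX hZ, superSign_comm (a + b) c,
    superSign_add_right, superSign_add_right, superSign_add_right, superSign_comm c a,
    superSign_comm c b, superSign_comm b a]
  have h := superSign_mul_self a b
  simp only [mul_sub, sub_mul, smul_sub, mul_smul_comm, smul_mul_assoc, smul_smul, mul_assoc,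
    ← mul_assoc (superSign a b) (superSign a b), h, one_mul]
  simp only [← mul_assoc]
  module

end FinMat

/-! ## The Lie superalgebra `B(∞,∞)` -/

namespace BInfty

open FinMat

/-- The matrix `I`. -/
def matI : Matrix (Fin 2) (Fin 2) ℂ := !![0, 1; 1, 0]

/-- The matrix `J`. -/
def matJ : Matrix (Fin 2) (Fin 2) ℂ := !![0, 1; -1, 0]

/-- The two row (or column) numbers belonging to the block index `i ≠ 0`: they are `2i-1, 2i` for
`i > 0` and `2i, 2i+1` for `i < 0`. (The block index `0` has the single number `0`.) -/
def pos (i : ℤ) (r : Fin 2) : ℤ := if 0 < i then 2 * i - 1 + (r : ℕ) else 2 * i + (r : ℕ)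

/-- The `2 × 2` block `X_{ij}`, for nonzero `i`, `j`. -/
def blk (X : FinMat) (i j : ℤ) : Matrix (Fin 2) (Fin 2) ℂ :=
  Matrix.of fun r s => X.1 (pos i r) (pos j s)

/-- The `1 × 2` block `X_{0j}`, for nonzero `j`. -/
def rowBlk (X : FinMat) (j : ℤ) : Matrix (Fin 1) (Fin 2) ℂ := Matrix.of fun _ s => X.1 0 (pos j s)

/-- The `2 × 1` block `X_{i0}`, for nonzero `i`. -/
def colBlk (X : FinMat) (i : ℤ) : Matrix (Fin 2) (Fin 1) ℂ := Matrix.of fun r _ => X.1 (pos i r) 0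

/-- The block conditions that define `B(∞,∞)` inside the finitary matrices. -/
structure Mem (X : FinMat) : Prop where
  neg_neg : ∀ i j : ℤ, 0 < i → 0 < j → matI * blk X (-i) (-j) + (blk X (-j) (-i))ᵀ * matI = 0
  pos_pos : ∀ i j : ℤ, 0 < i → 0 < j → matJ * blk X i j + (blk X j i)ᵀ * matJ = 0
  neg_pos : ∀ i j : ℤ, 0 < i → 0 < j → matI * blk X (-i) j - (blk X j (-i))ᵀ * matJ = 0
  zero_neg : ∀ j : ℤ, 0 < j → rowBlk X (-j) + (colBlk X (-j))ᵀ * matI = 0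
  zero_pos : ∀ j : ℤ, 0 < j → rowBlk X j - (colBlk X j)ᵀ * matJ = 0
  zero_zero : X.1 0 0 = 0

/-- The other number in the same block. -/
def partner (k : ℤ) : ℤ :=
  if k = 0 then 0 else if 0 < k then (if k % 2 = 1 then k + 1 else k - 1)
  else (if k % 2 = 0 then k + 1 else k - 1)

/-- The nonzero entries of the matrix `B` of the invariant form. -/
def beta (k : ℤ) : ℂ := if 0 < k ∧ k % 2 = 0 then -1 else 1

/-- The sign of the super transpose. -/
def tsign (a b : ZMod 2) : ℂ := if a = 0 ∧ b = 1 then -1 else 1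

theorem partner_partner (k : ℤ) : partner (partner k) = k := by
  unfold partner; grind

theorem idx_partner (k : ℤ) : idx (partner k) = idx k := by
  unfold partner idx; grind

theorem beta_mul_self (k : ℤ) : beta k * beta k = 1 := by
  unfold beta; split_ifs <;> norm_num

theorem pos_cases (k : ℤ) : k = 0 ∨ (∃ i, 0 < i ∧ k = pos i 0) ∨ (∃ i, 0 < i ∧ k = pos i 1) ∨
    (∃ i, 0 < i ∧ k = pos (-i) 0) ∨ (∃ i, 0 < i ∧ k = pos (-i) 1) := by
  rcases lt_trichotomy k 0 with h | h | h
  · rcases Int.even_or_odd' k with ⟨m, hm | hm⟩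
    · refine Or.inr (Or.inr (Or.inr (Or.inl ⟨-m, by omega, ?_⟩)))
      rw [pos, if_neg (by omega)]; simp; omega
    · refine Or.inr (Or.inr (Or.inr (Or.inr ⟨-m, by omega, ?_⟩)))
      rw [pos, if_neg (by omega)]; simp; omega
  · exact Or.inl h
  · rcases Int.even_or_odd' k with ⟨m, hm | hm⟩
    · refine Or.inr (Or.inr (Or.inl ⟨m, by omega, ?_⟩))
      rw [pos, if_pos (by omega)]; simp; omega
    · refine Or.inr (Or.inl ⟨m + 1, by omega, ?_⟩)
      rw [pos, if_pos (by omega)]; simp; omega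

theorem vals_zero : partner 0 = 0 ∧ beta 0 = 1 ∧ idx 0 = 0 := by
  simp [partner, beta, idx]

theorem vals_odd {i : ℤ} (h : 0 < i) : partner (pos i 0) = pos i 1 ∧ beta (pos i 0) = 1 ∧
    idx (pos i 0) = 1 := by
  have h0 : pos i 0 = 2 * i - 1 := by rw [pos, if_pos h]; simp
  have h1 : pos i 1 = 2 * i := by rw [pos, if_pos h]; simp
  rw [h0, h1]
  exact ⟨by unfold partner; grind, if_neg (by omega), if_pos (by omega)⟩

theorem vals_even {i : ℤ} (h : 0 < i) : partner (pos i 1) = pos i 0 ∧ beta (pos i 1) = -1 ∧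
    idx (pos i 1) = 1 := by
  have h0 : pos i 0 = 2 * i - 1 := by rw [pos, if_pos h]; simp
  have h1 : pos i 1 = 2 * i := by rw [pos, if_pos h]; simp
  rw [h0, h1]
  exact ⟨by unfold partner; grind, if_pos (by omega), if_pos (by omega)⟩

theorem vals_neg_even {i : ℤ} (h : 0 < i) : partner (pos (-i) 0) = pos (-i) 1 ∧
    beta (pos (-i) 0) = 1 ∧ idx (pos (-i) 0) = 0 := by
  have h0 : pos (-i) 0 = -(2 * i) := by rw [pos, if_neg (by omega)]; simp
  have h1 : pos (-i) 1 = -(2 * i) + 1 := by rw [pos, if_neg (by omega)]; simp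
  rw [h0, h1]
  exact ⟨by unfold partner; grind, if_neg (by omega), if_neg (by omega)⟩

theorem vals_neg_odd {i : ℤ} (h : 0 < i) : partner (pos (-i) 1) = pos (-i) 0 ∧
    beta (pos (-i) 1) = 1 ∧ idx (pos (-i) 1) = 0 := by
  have h0 : pos (-i) 0 = -(2 * i) := by rw [pos, if_neg (by omega)]; simp
  have h1 : pos (-i) 1 = -(2 * i) + 1 := by rw [pos, if_neg (by omega)]; simp
  rw [h0, h1]
  exact ⟨by unfold partner; grind, if_neg (by omega), if_neg (by omega)⟩

theorem nn_iff (M N : Matrix (Fin 2) (Fin 2) ℂ) : matI * M + Nᵀ * matI = 0 ↔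
    (M 1 0 + N 1 0 = 0 ∧ M 1 1 + N 0 0 = 0) ∧ (M 0 0 + N 1 1 = 0 ∧ M 0 1 + N 0 1 = 0) := by
  simp [← Matrix.ext_iff, Fin.forall_fin_two, matI, Matrix.mul_apply,
    Matrix.vecMul, dotProduct, Fin.sum_univ_two]

theorem pp_iff (M N : Matrix (Fin 2) (Fin 2) ℂ) : matJ * M + Nᵀ * matJ = 0 ↔
    (M 1 0 + -N 1 0 = 0 ∧ M 1 1 + N 0 0 = 0) ∧ (-M 0 0 + -N 1 1 = 0 ∧ -M 0 1 + N 0 1 = 0) := by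
  simp [← Matrix.ext_iff, Fin.forall_fin_two, matJ, Matrix.mul_apply,
    Matrix.vecMul, dotProduct, Fin.sum_univ_two]

theorem np_iff (M N : Matrix (Fin 2) (Fin 2) ℂ) : matI * M - Nᵀ * matJ = 0 ↔
    (M 1 0 + N 1 0 = 0 ∧ M 1 1 - N 0 0 = 0) ∧ (M 0 0 + N 1 1 = 0 ∧ M 0 1 - N 0 1 = 0) := by
  simp [← Matrix.ext_iff, Fin.forall_fin_two, matI, matJ, Matrix.mul_apply,
    Matrix.vecMul, dotProduct, Fin.sum_univ_two]

theorem zn_iff (M : Matrix (Fin 1) (Fin 2) ℂ) (N : Matrix (Fin 2) (Fin 1) ℂ) :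
    M + Nᵀ * matI = 0 ↔ M 0 0 + N 1 0 = 0 ∧ M 0 1 + N 0 0 = 0 := by
  simp [← Matrix.ext_iff, Fin.forall_fin_two, matI, Matrix.mul_apply, Fin.sum_univ_two]

theorem zp_iff (M : Matrix (Fin 1) (Fin 2) ℂ) (N : Matrix (Fin 2) (Fin 1) ℂ) :
    M - Nᵀ * matJ = 0 ↔ M 0 0 + N 1 0 = 0 ∧ M 0 1 - N 0 0 = 0 := by
  simp [← Matrix.ext_iff, Fin.forall_fin_two, matJ, Matrix.mul_apply, Fin.sum_univ_two]

/-- The block conditions for the entries `f`, written out. -/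
def Entries (f : ℤ → ℤ → ℂ) : Prop :=
  (∀ i j : ℤ, 0 < i → 0 < j →
    ((f (pos (-i) 1) (pos (-j) 0) + f (pos (-j) 1) (pos (-i) 0) = 0 ∧
      f (pos (-i) 1) (pos (-j) 1) + f (pos (-j) 0) (pos (-i) 0) = 0) ∧
      (f (pos (-i) 0) (pos (-j) 0) + f (pos (-j) 1) (pos (-i) 1) = 0 ∧
        f (pos (-i) 0) (pos (-j) 1) + f (pos (-j) 0) (pos (-i) 1) = 0)) ∧
    ((f (pos i 1) (pos j 0) + -f (pos j 1) (pos i 0) = 0 ∧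
      f (pos i 1) (pos j 1) + f (pos j 0) (pos i 0) = 0) ∧
      (-f (pos i 0) (pos j 0) + -f (pos j 1) (pos i 1) = 0 ∧
        -f (pos i 0) (pos j 1) + f (pos j 0) (pos i 1) = 0)) ∧
    ((f (pos (-i) 1) (pos j 0) + f (pos j 1) (pos (-i) 0) = 0 ∧
      f (pos (-i) 1) (pos j 1) - f (pos j 0) (pos (-i) 0) = 0) ∧
      (f (pos (-i) 0) (pos j 0) + f (pos j 1) (pos (-i) 1) = 0 ∧
        f (pos (-i) 0) (pos j 1) - f (pos j 0) (pos (-i) 1) = 0))) ∧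
  (∀ j : ℤ, 0 < j →
    (f 0 (pos (-j) 0) + f (pos (-j) 1) 0 = 0 ∧ f 0 (pos (-j) 1) + f (pos (-j) 0) 0 = 0) ∧
    (f 0 (pos j 0) + f (pos j 1) 0 = 0 ∧ f 0 (pos j 1) - f (pos j 0) 0 = 0)) ∧
  f 0 0 = 0

theorem mem_iff_entries (X : FinMat) : Mem X ↔ Entries X.1 := by
  constructor
  · rintro ⟨hnn, hpp, hnp, hzn, hzp, hzz⟩
    exact ⟨fun i j hi hj => ⟨(nn_iff _ _).1 (hnn i j hi hj), (pp_iff _ _).1 (hpp i j hi hj),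
      (np_iff _ _).1 (hnp i j hi hj)⟩,
      fun j hj => ⟨(zn_iff _ _).1 (hzn j hj), (zp_iff _ _).1 (hzp j hj)⟩, hzz⟩
  · rintro ⟨h, hz, hzz⟩
    exact ⟨fun i j hi hj => (nn_iff _ _).2 (h i j hi hj).1,
      fun i j hi hj => (pp_iff _ _).2 (h i j hi hj).2.1,
      fun i j hi hj => (np_iff _ _).2 (h i j hi hj).2.2,
      fun j hj => (zn_iff _ _).2 (hz j hj).1,
      fun j hj => (zp_iff _ _).2 (hz j hj).2, hzz⟩

theorem entries_iff (f : ℤ → ℤ → ℂ) :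
    Entries f ↔ ∀ k l, f (partner k) (partner l)
      = -(tsign (idx k) (idx l) * beta k * beta l * f l k) := by
  have t00 : tsign 0 0 = 1 := by simp [tsign]
  have t01 : tsign 0 1 = -1 := by simp [tsign]
  have t10 : tsign 1 0 = 1 := by simp [tsign]
  have t11 : tsign 1 1 = 1 := by simp [tsign]
  constructor
  · rintro ⟨h, hz, hzz⟩ k l
    rcases pos_cases k with rfl | ⟨i, hi, rfl⟩ | ⟨i, hi, rfl⟩ | ⟨i, hi, rfl⟩ | ⟨i, hi, rfl⟩ <;>
    rcases pos_cases l with rfl | ⟨j, hj, rfl⟩ | ⟨j, hj, rfl⟩ | ⟨j, hj, rfl⟩ | ⟨j, hj, rfl⟩ <;>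
    simp (discharger := assumption) only [vals_zero, vals_odd, vals_even, vals_neg_even,
      vals_neg_odd, t00, t01, t10, t11]
    all_goals first
      | (have h1 := h i j hi hj
         have h2 := h j i hj hi
         clear h hz t00 t01 t10 t11
         grind)
      | (have h1 := hz i hi
         clear h hz t00 t01 t10 t11
         grind)
      | (have h1 := hz j hj
         clear h hz t00 t01 t10 t11
         grind)
      | grind
  · intro h
    refine ⟨fun i j hi hj => ⟨⟨⟨?_, ?_⟩, ?_, ?_⟩, ⟨⟨?_, ?_⟩, ?_, ?_⟩, ⟨?_, ?_⟩, ?_, ?_⟩,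
      fun j hj => ⟨⟨?_, ?_⟩, ?_, ?_⟩, ?_⟩
    · have := h (pos (-i) 0) (pos (-j) 1)
      simp only [vals_neg_even, vals_neg_odd, hi, hj, t00] at this
      linear_combination this
    · have := h (pos (-i) 0) (pos (-j) 0)
      simp only [vals_neg_even, hi, hj, t00] at this
      linear_combination this
    · have := h (pos (-i) 1) (pos (-j) 1)
      simp only [vals_neg_odd, hi, hj, t00] at this
      linear_combination this
    · have := h (pos (-i) 1) (pos (-j) 0)
      simp only [vals_neg_even, vals_neg_odd, hi, hj, t00] at this
      linear_combination this
    · have := h (pos i 0) (pos j 1)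
      simp only [vals_even, vals_odd, hi, hj, t11] at this
      linear_combination this
    · have := h (pos i 0) (pos j 0)
      simp only [vals_odd, hi, hj, t11] at this
      linear_combination this
    · have := h (pos i 1) (pos j 1)
      simp only [vals_even, hi, hj, t11] at this
      linear_combination -this
    · have := h (pos i 1) (pos j 0)
      simp only [vals_even, vals_odd, hi, hj, t11] at this
      linear_combination -this
    · have := h (pos (-i) 0) (pos j 1)
      simp only [vals_even, vals_neg_even, hi, hj, t01] at this
      linear_combination this
    · have := h (pos (-i) 0) (pos j 0)
      simp only [vals_odd, vals_neg_even, hi, hj, t01] at this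
      linear_combination this
    · have := h (pos (-i) 1) (pos j 1)
      simp only [vals_even, vals_neg_odd, hi, hj, t01] at this
      linear_combination this
    · have := h (pos (-i) 1) (pos j 0)
      simp only [vals_odd, vals_neg_odd, hi, hj, t01] at this
      linear_combination this
    · have := h 0 (pos (-j) 1)
      simp only [vals_zero, vals_neg_odd, hj, t00] at this
      linear_combination this
    · have := h 0 (pos (-j) 0)
      simp only [vals_zero, vals_neg_even, hj, t00] at this
      linear_combination this
    · have := h 0 (pos j 1)
      simp only [vals_zero, vals_even, hj, t01] at this
      linear_combination this
    · have := h 0 (pos j 0)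
      simp only [vals_zero, vals_odd, hj, t01] at this
      linear_combination this
    · have := h 0 0
      simp only [vals_zero, t00] at this
      linear_combination (1 / 2 : ℂ) * this

/-- The block conditions as one condition on the entries. -/
theorem mem_iff (X : FinMat) :
    Mem X ↔ ∀ k l, X.1 (partner k) (partner l)
      = -(tsign (idx k) (idx l) * beta k * beta l * X.1 l k) :=
  (mem_iff_entries X).trans (entries_iff X.1)

theorem tsign_mul {a b x y z : ZMod 2} (h1 : x + y = a) (h2 : y + z = b) :
    tsign x y * tsign y z = superSign a b * tsign x z := by
  have h2' : ∀ z : ZMod 2, z = 0 ∨ z = 1 := by decide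
  have h11 : (1 + 1 : ZMod 2) = 0 := by decide
  subst h1 h2
  rcases h2' x with rfl | rfl <;> rcases h2' y with rfl | rfl <;> rcases h2' z with rfl | rfl <;>
    simp [superSign, tsign, h11, ZMod.val_one]

theorem mul_partner {a b : ZMod 2} {X Y : FinMat} (hX : Mem X) (hY : Mem Y)
    (hXa : X ∈ homog a) (hYb : Y ∈ homog b) (k l : ℤ) :
    (X * Y).1 (partner k) (partner l)
      = superSign a b * (tsign (idx k) (idx l) * beta k * beta l * (Y * X).1 l k) := by
  rw [mem_iff] at hX hY
  obtain ⟨s, hs⟩ := exists_bound X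
  rw [mul_eq_right _ hs, mul_apply,
    ← finsum_comp_equiv (⟨partner, partner, partner_partner, partner_partner⟩ : ℤ ≃ ℤ)]
  have key : ∀ m, X.1 (partner k) (partner m) * Y.1 (partner m) (partner l)
      = superSign a b * (tsign (idx k) (idx l) * beta k * beta l * (Y.1 l m * X.1 m k)) := by
    intro m
    rw [hX, hY]
    by_cases h1 : idx k + idx m = a
    · by_cases h2 : idx m + idx l = b
      · have ht := tsign_mul h1 h2
        have hb := beta_mul_self m
        linear_combination (beta k * beta l * X.1 m k * Y.1 l m) *
          (beta m * beta m * ht + superSign a b * tsign (idx k) (idx l) * hb)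
      · rw [hYb l m (by rwa [add_comm])]; ring
    · rw [hXa m k (by rwa [add_comm])]; ring
  simp only [Equiv.coe_fn_mk, key]
  rw [finsum_eq_sum_of_support_subset (s := s)]
  · simp only [Finset.mul_sum]
  · intro m hm
    have : X.1 m k ≠ 0 := fun h0 => hm (by simp [h0])
    exact (hs _ _ this).1

theorem superBracket_mem_of_homog {a b : ZMod 2} {X Y : FinMat} (hX : Mem X) (hY : Mem Y)
    (hXa : X ∈ homog a) (hYb : Y ∈ homog b) : Mem (superBracket X Y) := by
  have h1 := mul_partner hX hY hXa hYb
  have h2 := mul_partner hY hX hYb hXa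
  rw [superBracket_apply hXa hYb, mem_iff]
  intro k l
  have hs := superSign_mul_self a b
  rw [sub_apply, sub_apply, smul_apply, smul_apply, h1, h2, superSign_comm b a]
  linear_combination (-(tsign (idx k) (idx l) * beta k * beta l * (X * Y).1 l k)) * hs

/-- The underlying space of `B(∞,∞)`. -/
def carrier : Submodule ℂ FinMat where
  carrier := {X | Mem X}
  zero_mem' := by
    rw [Set.mem_ofPred_eq, mem_iff]
    intro k l
    simp [zero_apply]
  add_mem' {X Y} hX hY := by
    rw [Set.mem_ofPred_eq, mem_iff] at *
    intro k l
    rw [add_apply, add_apply, hX, hY]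
    ring
  smul_mem' c X hX := by
    rw [Set.mem_ofPred_eq, mem_iff] at *
    intro k l
    rw [smul_apply, smul_apply, hX]
    ring

theorem part_mem_carrier (a : ZMod 2) {X : FinMat} (hX : X ∈ carrier) : part a X ∈ carrier := by
  change Mem X at hX
  change Mem (part a X)
  rw [mem_iff] at *
  intro k l
  rw [part_apply, part_apply, hX, idx_partner, idx_partner, add_comm (idx l)]
  split_ifs <;> simp

theorem superBracket_mem_carrier {X Y : FinMat} (hX : X ∈ carrier) (hY : Y ∈ carrier) :
    superBracket X Y ∈ carrier := by
  rw [← part_add_part X, ← part_add_part Y]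
  simp only [map_add, LinearMap.add_apply]
  have h : ∀ a b, superBracket (part a X) (part b Y) ∈ carrier := fun a b =>
    superBracket_mem_of_homog (part_mem_carrier a hX) (part_mem_carrier b hY)
      (part_mem a X) (part_mem b Y)
  exact add_mem (add_mem (h _ _) (h _ _)) (add_mem (h _ _) (h _ _))

end BInfty

/-- The space `B(∞,∞)`. -/
abbrev BInfty : Type := BInfty.carrier

namespace BInfty

open FinMat

/-- The superbracket restricted to `B(∞,∞)`. -/
def bracket : BInfty →ₗ[ℂ] BInfty →ₗ[ℂ] BInfty :=
  LinearMap.mk₂ ℂ (fun X Y => ⟨superBracket X.1 Y.1, superBracket_mem_carrier X.2 Y.2⟩)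
    (fun X Y Z => Subtype.ext (by simp)) (fun c X Y => Subtype.ext (by simp))
    (fun X Y Z => Subtype.ext (by simp)) (fun c X Y => Subtype.ext (by simp))

theorem bracket_coe (X Y : BInfty) : (bracket X Y).1 = superBracket X.1 Y.1 := rfl

instance : LieSuperalgebra BInfty where
  grade a := (homog a).comap carrier.subtype
  sbr := bracket
  isCompl := by
    constructor
    · rw [Submodule.disjoint_def]
      intro X h0 h1
      have h0' : X.1 ∈ homog 0 := h0
      have h1' : X.1 ∈ homog 1 := h1
      exact Subtype.ext ((part_same h0').symm.trans (part_ne h1' zero_ne_one))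
    · rw [codisjoint_iff, eq_top_iff]
      intro X _
      exact Submodule.mem_sup.2 ⟨⟨part 0 X.1, part_mem_carrier 0 X.2⟩, part_mem 0 X.1,
        ⟨part 1 X.1, part_mem_carrier 1 X.2⟩, part_mem 1 X.1, Subtype.ext (part_add_part X.1)⟩
  sbr_mem := fun hX hY => superBracket_mem hX hY
  skew := fun hX hY => Subtype.ext (superBracket_skew hX hY)
  jacobi := fun hX hY hZ => Subtype.ext (superBracket_jacobi hX hY hZ)

/-! ### The parafermion and paraboson operators -/

/-- The matrix of `c_i^ξ`, where `ξ = 1` stands for `+` and `ξ = -1` for `-`: parafermions for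
`i < 0` and parabosons for `i > 0`. -/
def cMat (i : ℤ) (ξ : ℤˣ) : FinMat :=
  if i < 0 then
    if ξ = 1 then (Real.sqrt 2 : ℂ) • (e (2 * i) 0 - e 0 (2 * i + 1))
    else (Real.sqrt 2 : ℂ) • (e 0 (2 * i) - e (2 * i + 1) 0)
  else
    if ξ = 1 then (Real.sqrt 2 : ℂ) • (e 0 (2 * i) + e (2 * i - 1) 0)
    else (Real.sqrt 2 : ℂ) • (e 0 (2 * i - 1) - e (2 * i) 0)

theorem e_apply (i j k l : ℤ) : (e i j).1 k l = if i = k ∧ j = l then 1 else 0 :=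
  Matrix.single_apply ..

theorem e_partner (i j k l : ℤ) :
    (e i j).1 (partner k) (partner l) = (e (partner i) (partner j)).1 k l := by
  have h : ∀ i k, i = partner k ↔ partner i = k := fun i k =>
    ⟨fun h => by rw [h, partner_partner], fun h => by rw [← h, partner_partner]⟩
  rw [e_apply, e_apply]
  simp only [h]

theorem e_swap (i j k l : ℤ) : (e i j).1 l k = (e j i).1 k l := by
  rw [e_apply, e_apply]
  simp only [and_comm]

theorem mem_of_signs {i : ℤ} {s : ℂ} (h1 : s = -(tsign 0 (idx i) * beta i))
    (h2 : s * beta (partner i) = -1) : e i 0 + s • e 0 (partner i) ∈ carrier := by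
  have hz := vals_zero
  have ht : ∀ a, tsign a 0 = 1 := fun a => by simp [tsign]
  change Mem _
  rw [mem_iff]
  intro k l
  simp only [add_apply, smul_apply, e_partner, partner_partner, hz.1]
  rw [e_swap i 0 k l, e_swap 0 (partner i) k l]
  have ha : (e 0 i).1 k l * s
      = -((e 0 i).1 k l * (tsign (idx k) (idx l) * beta k * beta l)) := by
    rw [e_apply]
    split_ifs with h
    · rw [← h.1, ← h.2, hz.2.1, hz.2.2, h1]; ring
    · simp
  have hb : (e (partner i) 0).1 k l
      = -((e (partner i) 0).1 k l * (tsign (idx k) (idx l) * beta k * beta l) * s) := by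
    rw [e_apply]
    split_ifs with h
    · rw [← h.1, ← h.2, hz.2.1, hz.2.2, ht]; linear_combination h2
    · simp
  linear_combination ha + hb

theorem cMat_mem {i : ℤ} (hi : i ≠ 0) (ξ : ℤˣ) : cMat i ξ ∈ carrier := by
  unfold cMat
  split_ifs with h hx hx
  · refine Submodule.smul_mem _ _ ?_
    have hp : partner (2 * i) = 2 * i + 1 := by unfold partner; grind
    have hm := mem_of_signs (i := 2 * i) (s := -1)
      (by rw [show idx (2 * i) = 0 from if_neg (by omega),
            show beta (2 * i) = 1 from if_neg (by omega)]; simp [tsign])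
      (by rw [hp, show beta (2 * i + 1) = 1 from if_neg (by omega)]; simp)
    rw [hp] at hm
    convert hm using 1
    module
  · refine Submodule.smul_mem _ _ ?_
    have hp : partner (2 * i + 1) = 2 * i := by unfold partner; grind
    have hm := mem_of_signs (i := 2 * i + 1) (s := -1)
      (by rw [show idx (2 * i + 1) = 0 from if_neg (by omega),
            show beta (2 * i + 1) = 1 from if_neg (by omega)]; simp [tsign])
      (by rw [hp, show beta (2 * i) = 1 from if_neg (by omega)]; simp)
    rw [hp] at hm
    convert neg_mem hm using 1
    module
  · refine Submodule.smul_mem _ _ ?_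
    have hp : partner (2 * i - 1) = 2 * i := by unfold partner; grind
    have hm := mem_of_signs (i := 2 * i - 1) (s := 1)
      (by rw [show idx (2 * i - 1) = 1 from if_pos (by omega),
            show beta (2 * i - 1) = 1 from if_neg (by omega)]; simp [tsign])
      (by rw [hp, show beta (2 * i) = -1 from if_pos (by omega)]; simp)
    rw [hp] at hm
    convert hm using 1
    module
  · refine Submodule.smul_mem _ _ ?_
    have hp : partner (2 * i) = 2 * i - 1 := by unfold partner; grind
    have hm := mem_of_signs (i := 2 * i) (s := -1)
      (by rw [show idx (2 * i) = 1 from if_pos (by omega),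
            show beta (2 * i) = -1 from if_pos (by omega)]; simp [tsign])
      (by rw [hp, show beta (2 * i - 1) = 1 from if_neg (by omega)]; simp)
    rw [hp] at hm
    convert neg_mem hm using 1
    module

end BInfty

/-- The index set `ℤ \ {0}`. -/
abbrev ZStar : Type := {i : ℤ // i ≠ 0}

/-- The element `c_i^ξ` of `B(∞,∞)`. -/
def BInfty.c (i : ZStar) (ξ : ℤˣ) : BInfty := ⟨BInfty.cMat i.1 ξ, BInfty.cMat_mem i.2 ξ⟩

/-! ### The presentation by triple relations -/

namespace Parastatistics

/-- The degree `⟨i⟩` of `c_i^±`, as a natural number. -/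
def deg (i : ZStar) : ℕ := if 0 < i.1 then 1 else 0

/-- The right-hand side of the combined triple relation,
`-2 δ_{jl} δ_{ε,-ξ} ε^⟨l⟩ (-1)^(⟨k⟩⟨l⟩) c_k^η + 2 ε^⟨l⟩ δ_{kl} δ_{ε,-η} c_j^ξ`. -/
def tripleRHS {V : Type*} [AddCommGroup V] [Module ℂ V] (c : ZStar → ℤˣ → V)
    (j k l : ZStar) (ξ η ε : ℤˣ) : V :=
  (-2 * (if j = l then 1 else 0) * (if ε = -ξ then 1 else 0) * (((ε : ℤ) : ℂ) ^ deg l)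
    * (-1) ^ (deg k * deg l) : ℂ) • c k η
  + (2 * (((ε : ℤ) : ℂ) ^ deg l) * (if k = l then 1 else 0) * (if ε = -η then 1 else 0) : ℂ)
    • c j ξ

/-- The letters of the free algebra that correspond to the operators `c_i^ξ`. -/
def letter (i : ZStar) (ξ : ℤˣ) : FreeSuper.Free (ZStar × ℤˣ) :=
  FreeNonUnitalNonAssocAlgebra.of ℂ (i, ξ)

/-- The relator expressing `⟦⟦c_j^ξ, c_k^η⟧, c_l^ε⟧ = tripleRHS`. -/
def relator (j k l : ZStar) (ξ η ε : ℤˣ) : FreeSuper.Free (ZStar × ℤˣ) :=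
  (letter j ξ * letter k η) * letter l ε - tripleRHS letter j k l ξ η ε

/-- The presentation with generators `c_i^±` (of degree `⟨i⟩`) and the triple relations. -/
def presentation : SuperPresentation (ZStar × ℤˣ) where
  parity x := (deg x.1 : ZMod 2)
  relators := {r | ∃ j k l ξ η ε, r = relator j k l ξ η ε}
  homogeneous := by
    rintro _ ⟨j, k, l, ξ, η, ε, rfl⟩
    have hl : ∀ i ξ, letter i ξ ∈ FreeSuper.grade (fun x : ZStar × ℤˣ => (deg x.1 : ZMod 2))
        (deg i : ZMod 2) := fun i ξ => FreeSuper.of_mem_grade _ (i, ξ)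
    have h2 : ∀ x y : ZMod 2, x + y + x = y ∧ y + x + x = y := by decide
    refine ⟨(deg j : ZMod 2) + deg k + deg l, sub_mem
      (FreeSuper.mul_mem_grade (FreeSuper.mul_mem_grade (hl _ _) (hl _ _)) (hl _ _))
      (add_mem ?_ ?_)⟩
    · by_cases h : j = l
      · rw [h, (h2 _ _).1]
        exact Submodule.smul_mem _ _ (hl _ _)
      · simp [h]
    · by_cases h : k = l
      · rw [h, (h2 _ _).2]
        exact Submodule.smul_mem _ _ (hl _ _)
      · simp [h]

end Parastatistics

end

/-!
Write `c_a` for the generators, `a = (i, ξ)`, and number them by the nonzero integers so that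
`c_a = √2 (ξ_a e_{r(a),0} + u_a e_{0,r(a*)})`, where `a*` is the conjugate label `(i, -ξ)` and
`ξ_a, u_a` are signs. Then `r` is a bijection from the labels to `ℤ \ {0}`, and
`⟦c_a, c_b⟧ = 2 (ξ_a u_b e_{r(a),r(b*)} - (-1)^{|a||b|} ξ_b u_a e_{r(b),r(a*)})`
(`superBracket_cMat`). The triple relations follow by one more multiplication (`c_triple`).

*Generation.* The block conditions say that an element of `B(∞,∞)` is fixed by an involution which
permutes the matrix units up to sign, so the element is half the sum of its symmetrized matrix units
(`two_smul_eq_sum`), and every symmetrized matrix unit is zero, a multiple of some `c_a`, or a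
multiple of some `⟦c_a, c_b⟧` (`symm_e_mem`).

*Presentation.* In any Lie superalgebra with elements `f_a` satisfying the triple relations, the
span of all `f_a` and `⟦f_a, f_b⟧` is closed under the bracket, by the Jacobi identity
(`IsTripleFamily.sbr_mem`); hence it is the whole of the presented algebra (`quadraticSpan_gen`). On
such combinations the homomorphism to `B(∞,∞)` can be inverted by reading off matrix entries: the
column `0` of a matrix gives the coefficients of the generators, and the entries outside row and
column `0` those of the brackets (`reconstruct`). This linear left inverse makes a choice of a basis
unnecessary, since the super skew-symmetry of `⟦f_a, f_b⟧` is built into it. Injectivity follows,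
and surjectivity is generation. The homomorphism itself exists and is unique by the universal property
of the presentation (`SuperPresentation.lift`, `SuperPresentation.hom_ext`).
-/

noncomputable section

/-! ### The universal property of a presentation -/

namespace SuperPresentation

variable {X : Type*} (P : SuperPresentation X)

theorem sbr_mkQ (x y : FreeSuper.Free X) :
    sbr (P.ideal.mkQ x) (P.ideal.mkQ y) = P.ideal.mkQ (x * y) := rfl

theorem mkQ_eq_zero_of_mem {r : FreeSuper.Free X} (hr : r ∈ P.relators) : P.ideal.mkQ r = 0 :=
  (Submodule.Quotient.mk_eq_zero P.ideal).2 (.rel hr)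

theorem gen_mem_grade (x : X) :
    P.gen x ∈ (LieSuperalgebra.grade (P.parity x) : Submodule ℂ P.Algebra) :=
  ⟨_, FreeSuper.of_mem_grade _ x, rfl⟩

/-- The generators generate: a subspace that contains them and is closed under the bracket is
everything. -/
theorem eq_top_of_gen_mem {S : Submodule ℂ P.Algebra} (hgen : ∀ x, P.gen x ∈ S)
    (hsbr : ∀ x ∈ S, ∀ y ∈ S, sbr x y ∈ S) : S = ⊤ := by
  have hword : ∀ u : FreeMagma X, P.ideal.mkQ (MonoidAlgebra.single u 1) ∈ S := by
    intro u
    induction u with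
    | ih1 x => exact hgen x
    | ih2 u v hu hv =>
      have h := hsbr _ hu _ hv
      rwa [sbr_mkQ, MonoidAlgebra.single_mul_single, one_mul] at h
  rw [eq_top_iff]
  intro x _
  obtain ⟨f, rfl⟩ := P.ideal.mkQ_surjective x
  induction f using MonoidAlgebra.induction_linear with
  | zero => rw [map_zero]; exact zero_mem _
  | add f g hf hg => rw [map_add]; exact add_mem (hf trivial) (hg trivial)
  | single u c =>
    have h : (MonoidAlgebra.single u c : FreeSuper.Free X) = c • MonoidAlgebra.single u 1 := by
      simp [MonoidAlgebra.smul_single]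
    rw [h, map_smul]
    exact S.smul_mem _ (hword u)

variable {L : Type*} [AddCommGroup L] [Module ℂ L] [LieSuperalgebra L]

/-- Two homomorphisms out of a presented Lie superalgebra that agree on the generators are equal. -/
theorem hom_ext {φ ψ : LieSuperHom P.Algebra L}
    (h : ∀ x, φ.toLinearMap (P.gen x) = ψ.toLinearMap (P.gen x)) : φ = ψ := by
  have htop : LinearMap.eqLocus φ.toLinearMap ψ.toLinearMap = ⊤ :=
    P.eq_top_of_gen_mem h fun x hx y hy => by
      rw [LinearMap.mem_eqLocus] at hx hy ⊢
      rw [φ.map_sbr, ψ.map_sbr, hx, hy]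
  have hlin : φ.toLinearMap = ψ.toLinearMap := LinearMap.eqLocus_eq_top.1 htop
  cases φ; cases ψ; cases hlin; rfl

/-- A Lie superalgebra as a non-associative algebra, with the bracket as its product. -/
abbrev bracketRing (L : Type*) [AddCommGroup L] [Module ℂ L] [LieSuperalgebra L] :
    NonUnitalNonAssocRing L where
  mul x y := sbr x y
  left_distrib x y z := map_add (LieSuperalgebra.sbr x) y z
  right_distrib x y z := LinearMap.map_add₂ LieSuperalgebra.sbr x y z
  zero_mul x := LinearMap.map_zero₂ LieSuperalgebra.sbr x
  mul_zero x := map_zero (LieSuperalgebra.sbr x)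

/-- The evaluation of non-associative polynomials at elements of a Lie superalgebra: the linear map
that sends the letters to the given elements and products to brackets. -/
def evalFree (f : X → L) : FreeSuper.Free X →ₗ[ℂ] L :=
  letI := bracketRing L
  haveI : IsScalarTower ℂ L L := ⟨fun c x y => LinearMap.map_smul₂ LieSuperalgebra.sbr c x y⟩
  haveI : SMulCommClass ℂ L L := ⟨fun c x y => ((LieSuperalgebra.sbr x).map_smul c y).symm⟩
  (FreeNonUnitalNonAssocAlgebra.lift ℂ f : FreeSuper.Free X →ₙₐ[ℂ] L)

theorem evalFree_of (f : X → L) (x : X) :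
    evalFree f (FreeNonUnitalNonAssocAlgebra.of ℂ x) = f x :=
  letI := bracketRing L
  haveI : IsScalarTower ℂ L L := ⟨fun c x y => LinearMap.map_smul₂ LieSuperalgebra.sbr c x y⟩
  haveI : SMulCommClass ℂ L L := ⟨fun c x y => ((LieSuperalgebra.sbr x).map_smul c y).symm⟩
  FreeNonUnitalNonAssocAlgebra.lift_of_apply ℂ f x

theorem evalFree_mul (f : X → L) (x y : FreeSuper.Free X) :
    evalFree f (x * y) = sbr (evalFree f x) (evalFree f y) :=
  letI := bracketRing L
  haveI : IsScalarTower ℂ L L := ⟨fun c x y => LinearMap.map_smul₂ LieSuperalgebra.sbr c x y⟩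
  haveI : SMulCommClass ℂ L L := ⟨fun c x y => ((LieSuperalgebra.sbr x).map_smul c y).symm⟩
  map_mul (FreeNonUnitalNonAssocAlgebra.lift ℂ f : FreeSuper.Free X →ₙₐ[ℂ] L) x y

theorem evalFree_mem_grade {par : X → ZMod 2} {f : X → L}
    (hf : ∀ x, f x ∈ (LieSuperalgebra.grade (par x) : Submodule ℂ L)) {a : ZMod 2}
    {x : FreeSuper.Free X} (hx : x ∈ FreeSuper.grade par a) :
    evalFree f x ∈ (LieSuperalgebra.grade a : Submodule ℂ L) := by
  have hword : ∀ u : FreeMagma X, evalFree f (MonoidAlgebra.single u 1) ∈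
      (LieSuperalgebra.grade (FreeSuper.wordParity par u) : Submodule ℂ L) := by
    intro u
    induction u with
    | ih1 x => exact (evalFree_of f x).symm ▸ hf x
    | ih2 u v hu hv =>
      have h : (MonoidAlgebra.single (u * v) 1 : FreeSuper.Free X)
          = MonoidAlgebra.single u 1 * MonoidAlgebra.single v 1 := by
        rw [MonoidAlgebra.single_mul_single, one_mul]
      rw [h, evalFree_mul]
      exact LieSuperalgebra.sbr_mem hu hv
  have hle : FreeSuper.grade par a ≤ (LieSuperalgebra.grade a).comap (evalFree f) := by
    refine Submodule.span_le.2 ?_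
    rintro _ ⟨u, rfl, rfl⟩
    exact hword u
  exact hle hx

/-- Evaluation kills the consequences of the relators that it kills. -/
theorem evalFree_eq_zero {f : X → L}
    (hf : ∀ x, f x ∈ (LieSuperalgebra.grade (P.parity x) : Submodule ℂ L))
    (hrel : ∀ r ∈ P.relators, evalFree f r = 0) {x : FreeSuper.Free X}
    (hx : FreeSuper.InIdeal P.parity P.relators x) : evalFree f x = 0 := by
  induction hx with
  | rel hr => exact hrel _ hr
  | skew hx hy =>
    rw [map_add, map_smul, evalFree_mul, evalFree_mul]
    exact eq_neg_iff_add_eq_zero.1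
      (LieSuperalgebra.skew (evalFree_mem_grade hf hx) (evalFree_mem_grade hf hy))
  | jacobi hx hy hz =>
    simp only [map_sub, map_add, map_smul, evalFree_mul]
    exact sub_eq_zero.2 (LieSuperalgebra.jacobi (evalFree_mem_grade hf hx)
      (evalFree_mem_grade hf hy) (evalFree_mem_grade hf hz))
  | zero => exact map_zero _
  | add _ _ h h' => rw [map_add, h, h', add_zero]
  | smul c _ h => rw [map_smul, h, smul_zero]
  | mul_left z _ h => rw [evalFree_mul, h]; exact map_zero _
  | mul_right z _ h => rw [evalFree_mul, h]; exact LinearMap.map_zero₂ _ _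

/-- The homomorphism out of a presented Lie superalgebra that is determined by homogeneous elements
of the prescribed parities satisfying the relators. -/
def lift (f : X → L) (hf : ∀ x, f x ∈ (LieSuperalgebra.grade (P.parity x) : Submodule ℂ L))
    (hrel : ∀ r ∈ P.relators, evalFree f r = 0) : LieSuperHom P.Algebra L where
  toLinearMap := P.ideal.liftQ (evalFree f) fun _ hx => P.evalFree_eq_zero hf hrel hx
  map_grade := by
    rintro a _ ⟨x, hx, rfl⟩
    exact evalFree_mem_grade hf hx
  map_sbr x y := by
    obtain ⟨x, rfl⟩ := P.ideal.mkQ_surjective x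
    obtain ⟨y, rfl⟩ := P.ideal.mkQ_surjective y
    exact evalFree_mul f x y

theorem lift_gen (f : X → L)
    (hf : ∀ x, f x ∈ (LieSuperalgebra.grade (P.parity x) : Submodule ℂ L))
    (hrel : ∀ r ∈ P.relators, evalFree f r = 0) (x : X) :
    (P.lift f hf hrel).toLinearMap (P.gen x) = f x :=
  evalFree_of f x

end SuperPresentation

/-! ### The matrices of the generators -/

namespace BInfty

open FinMat

theorem e_mul_e (i j k l : ℤ) : e i j * e k l = if j = k then e i l else 0 := by
  ext m n
  have h : (e i j * e k l).1 m n = ∑ q ∈ {j}, (e i j).1 m q * (e k l).1 q n :=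
    mulFun_eq_left _ (fun m q hq => by
      rw [e_apply] at hq
      simp only [ne_eq, ite_eq_right_iff, not_forall] at hq
      simp [hq.1.2]) m n
  rw [h, Finset.sum_singleton]
  split_ifs with hjk
  · subst hjk
    simp only [e_apply]
    grind
  · simp only [e_apply, zero_apply]
    grind

theorem e_mem_homog (i j : ℤ) : e i j ∈ homog (idx i + idx j) := fun k l h => by
  rw [e_apply, if_neg]
  rintro ⟨rfl, rfl⟩
  exact h rfl

/-- The labels `(i, ξ)` of the generators `c_i^ξ`. -/
abbrev Label : Type := ZStar × ℤˣ

namespace Label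

/-- The label of the generator conjugate to the given one, `c_i^ξ ↦ c_i^{-ξ}`. -/
def conj (a : Label) : Label := (a.1, -a.2)

/-- The parity of a generator. -/
def par (a : Label) : ZMod 2 := (Parastatistics.deg a.1 : ZMod 2)

/-- The row in which the matrix of a generator has its entry in column `0`. -/
def row (a : Label) : ℤ :=
  if 0 < a.1.1 then (if a.2 = 1 then 2 * a.1.1 - 1 else 2 * a.1.1)
  else (if a.2 = 1 then 2 * a.1.1 else 2 * a.1.1 + 1)

/-- The coefficient `ξ` of `c_i^ξ` in column `0`, up to the factor `√2`. -/
def colCoeff (a : Label) : ℂ := ((a.2 : ℤ) : ℂ)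

/-- The coefficient of `c_i^ξ` in row `0`, up to the factor `√2`. -/
def rowCoeff (a : Label) : ℂ := if 0 < a.1.1 then 1 else -((a.2 : ℤ) : ℂ)

theorem neg_one_units_ne_one : (-1 : ℤˣ) ≠ 1 := by decide

theorem row_ne_zero (a : Label) : row a ≠ 0 := by
  obtain ⟨⟨i, hi⟩, ξ⟩ := a
  unfold row
  grind

theorem row_injective : Function.Injective row := by
  rintro ⟨⟨i, hi⟩, ξ⟩ ⟨⟨j, hj⟩, η⟩ h
  rcases Int.units_eq_one_or ξ with rfl | rfl <;> rcases Int.units_eq_one_or η with rfl | rfl <;>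
    simp only [row, neg_one_units_ne_one, if_true, if_false, Prod.mk.injEq,
      Subtype.mk.injEq] at h ⊢ <;> grind

theorem row_surjective {k : ℤ} (hk : k ≠ 0) : ∃ a, row a = k := by
  rcases lt_or_gt_of_ne hk with h | h <;> rcases Int.even_or_odd' k with ⟨m, rfl | rfl⟩
  · exact ⟨(⟨m, by omega⟩, 1), by simp only [row, if_true]; grind⟩
  · exact ⟨(⟨m, by omega⟩, -1), by simp only [row, neg_one_units_ne_one, if_false]; grind⟩
  · exact ⟨(⟨m, by omega⟩, -1), by simp only [row, neg_one_units_ne_one, if_false]; grind⟩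
  · exact ⟨(⟨m + 1, by omega⟩, 1), by simp only [row, if_true]; grind⟩

theorem row_inj {a b : Label} : row a = row b ↔ a = b := row_injective.eq_iff

theorem conj_conj (a : Label) : conj (conj a) = a := by simp [conj]

theorem conj_injective : Function.Injective conj :=
  Function.LeftInverse.injective conj_conj

theorem conj_eq_comm {a b : Label} : conj a = b ↔ conj b = a :=
  ⟨fun h => h ▸ conj_conj a, fun h => h ▸ conj_conj b⟩

theorem par_conj (a : Label) : par (conj a) = par a := rfl

theorem partner_row (a : Label) : partner (row a) = row (conj a) := by
  obtain ⟨⟨i, hi⟩, ξ⟩ := a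
  rcases Int.units_eq_one_or ξ with rfl | rfl <;>
    simp only [row, conj, neg_neg, neg_one_units_ne_one, if_true, if_false] <;>
    unfold partner <;> grind

theorem idx_row (a : Label) : idx (row a) = par a := by
  obtain ⟨⟨i, hi⟩, ξ⟩ := a
  rcases lt_or_gt_of_ne hi with h | h <;> rcases Int.units_eq_one_or ξ with rfl | rfl <;>
    simp only [row, idx, par, Parastatistics.deg, neg_one_units_ne_one, h, not_lt.2 h.le,
      if_true, if_false] <;> grind

theorem colCoeff_mul_self (a : Label) : colCoeff a * colCoeff a = 1 := by
  obtain ⟨i, ξ⟩ := a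
  rcases Int.units_eq_one_or ξ with rfl | rfl <;> simp [colCoeff]

theorem rowCoeff_mul_self (a : Label) : rowCoeff a * rowCoeff a = 1 := by
  obtain ⟨i, ξ⟩ := a
  rcases Int.units_eq_one_or ξ with rfl | rfl <;> by_cases h : 0 < i.1 <;> simp [rowCoeff, h]

theorem colCoeff_conj (a : Label) : colCoeff (conj a) = -colCoeff a := by
  simp [colCoeff, conj]

theorem rowCoeff_conj (a : Label) :
    rowCoeff (conj a) = -superSign (par a) (par a) * rowCoeff a := by
  by_cases h : 0 < a.1.1 <;>
    simp [rowCoeff, conj, par, Parastatistics.deg, superSign, ZMod.val_one, h]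

end Label

open Label

theorem cMat_eq (a : Label) : cMat a.1.1 a.2 = (Real.sqrt 2 : ℂ) •
    (colCoeff a • e (row a) 0 + rowCoeff a • e 0 (row (conj a))) := by
  obtain ⟨⟨i, hi⟩, ξ⟩ := a
  rcases lt_or_gt_of_ne hi with h | h <;> rcases Int.units_eq_one_or ξ with rfl | rfl <;>
    simp only [cMat, row, conj, colCoeff, rowCoeff, neg_neg, neg_one_units_ne_one, h, not_lt.2 h.le,
      if_true, if_false] <;> push_cast <;> module

theorem cMat_mem_homog (a : Label) : cMat a.1.1 a.2 ∈ homog (par a) := by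
  have h1 := e_mem_homog (row a) 0
  have h2 := e_mem_homog 0 (row (conj a))
  rw [vals_zero.2.2, idx_row, add_zero] at h1
  rw [vals_zero.2.2, idx_row, par_conj, zero_add] at h2
  rw [cMat_eq]
  exact Submodule.smul_mem _ _ (add_mem (Submodule.smul_mem _ _ h1) (Submodule.smul_mem _ _ h2))

theorem sqrt_two_mul_self : (Real.sqrt 2 : ℂ) * (Real.sqrt 2 : ℂ) = 2 := by
  rw [← Complex.ofReal_mul, Real.mul_self_sqrt (by norm_num)]; norm_num

/-- The product of two generators, with a contribution at `e_{00}` when they are conjugate. -/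
theorem cMat_mul_cMat (a b : Label) : cMat a.1.1 a.2 * cMat b.1.1 b.2
    = (2 * colCoeff a * rowCoeff b) • e (row a) (row (conj b))
      + (if conj a = b then 2 * rowCoeff a * colCoeff b else 0) • e 0 0 := by
  rw [cMat_eq, cMat_eq, smul_mul_smul_comm, sqrt_two_mul_self]
  simp only [mul_add, add_mul, smul_mul_smul_comm, e_mul_e, row_inj, row_ne_zero,
    (row_ne_zero _).symm, if_true, if_false]
  split_ifs <;> module

/-- The bracket of two generators: the contributions of `e_{00}` cancel. -/
theorem superBracket_cMat (a b : Label) : superBracket (cMat a.1.1 a.2) (cMat b.1.1 b.2)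
    = (2 : ℂ) • ((colCoeff a * rowCoeff b) • e (row a) (row (conj b))
      - (superSign (par a) (par b) * (colCoeff b * rowCoeff a)) • e (row b) (row (conj a))) := by
  rw [superBracket_apply (cMat_mem_homog a) (cMat_mem_homog b), cMat_mul_cMat, cMat_mul_cMat]
  by_cases h : conj a = b
  · subst h
    have hs := superSign_mul_self (par a) (par a)
    simp only [conj_conj, if_true, par_conj, colCoeff_conj, rowCoeff_conj]
    match_scalars
    · ring
    · linear_combination (2 * rowCoeff a * colCoeff a) * hs
    · ring
  · have h' : ¬ conj b = a := fun h' => h (conj_eq_comm.1 h')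
    simp only [h, h', if_false]
    module

/-- The double bracket of generators, before the coefficients are brought into the form of the
triple relations. -/
theorem superBracket_superBracket_cMat (a b c : Label) :
    superBracket (superBracket (cMat a.1.1 a.2) (cMat b.1.1 b.2)) (cMat c.1.1 c.2)
      = (if conj b = c then 2 * (rowCoeff b * colCoeff c) else 0) • cMat a.1.1 a.2
        - (if conj a = c then 2 * (superSign (par a) (par b) * (rowCoeff a * colCoeff c)) else 0)
          • cMat b.1.1 b.2 := by
  rw [superBracket_apply (superBracket_mem (cMat_mem_homog a) (cMat_mem_homog b))
    (cMat_mem_homog c), superBracket_cMat]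
  simp only [cMat_eq, mul_add, add_mul, sub_mul, mul_sub, smul_mul_smul_comm, e_mul_e, row_inj,
    row_ne_zero, (row_ne_zero _).symm, if_false, conj_eq_comm (a := c)]
  have hs := superSign_mul_self (par a) (par b)
  rw [superSign_comm (par a + par b), superSign_add_right, superSign_comm (par c) (par a),
    superSign_comm (par c) (par b)]
  by_cases hb : conj b = c <;> by_cases ha : conj a = c
  · obtain rfl : a = b := conj_injective (ha.trans hb.symm)
    subst hb
    simp only [if_true, par_conj, colCoeff_conj, rowCoeff_conj]
    match_scalars
    · ring
    · linear_combination (2 * Real.sqrt 2 * rowCoeff a * rowCoeff a * colCoeff a *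
        (superSign (par a) (par a) - superSign (par a) (par a) * superSign (par a) (par a) - 1))
        * hs
  · have hb' := superSign_mul_self (par b) (par b)
    subst hb
    simp only [ha, if_true, if_false, par_conj, colCoeff_conj, rowCoeff_conj, zero_smul, sub_zero]
    match_scalars
    · ring
    · linear_combination (-2 * Real.sqrt 2 * rowCoeff b * colCoeff b * rowCoeff a) *
        (superSign (par b) (par b) * superSign (par b) (par b) * hs + hb')
  · have ha' := superSign_mul_self (par a) (par a)
    subst ha
    simp only [hb, if_true, if_false, par_conj, colCoeff_conj, rowCoeff_conj, zero_smul, zero_sub,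
      superSign_comm (par b) (par a)]
    match_scalars
    · ring
    · linear_combination (2 * Real.sqrt 2 * rowCoeff a * colCoeff a * rowCoeff b *
        superSign (par a) (par b)) * ha'
  · simp only [ha, hb, if_false]
    module

/-! ### The triple relations -/

/-- For the conjugate generator `c_i^ε`, with `ε = -ξ`, this is the factor `ε^⟨i⟩` of the triple
relations. -/
theorem rowCoeff_mul_colCoeff_conj (a : Label) :
    rowCoeff a * colCoeff (conj a) = (((conj a).2 : ℤ) : ℂ) ^ Parastatistics.deg a.1 := by
  obtain ⟨i, ξ⟩ := a
  rcases Int.units_eq_one_or ξ with rfl | rfl <;> by_cases h : 0 < i.1 <;>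
    simp [rowCoeff, colCoeff, conj, Parastatistics.deg, h]

theorem superSign_par (a b : Label) :
    superSign (par a) (par b) = (-1) ^ (Parastatistics.deg a.1 * Parastatistics.deg b.1) := by
  by_cases ha : 0 < a.1.1 <;> by_cases hb : 0 < b.1.1 <;>
    simp [superSign, par, Parastatistics.deg, ha, hb, ZMod.val_one]

theorem conj_eq_iff {i j : ZStar} {ξ η : ℤˣ} : conj (i, ξ) = (j, η) ↔ i = j ∧ η = -ξ := by
  rw [conj, Prod.mk.injEq, eq_comm (a := -ξ)]

/-- The matrices `c_i^ξ` satisfy the triple relations. -/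
theorem c_triple (j k l : ZStar) (ξ η ε : ℤˣ) :
    sbr (sbr (c j ξ) (c k η)) (c l ε) = Parastatistics.tripleRHS c j k l ξ η ε := by
  refine Subtype.ext ((superBracket_superBracket_cMat (j, ξ) (k, η) (l, ε)).trans ?_)
  have hb : (if conj (k, η) = (l, ε) then 2 * (rowCoeff (k, η) * colCoeff (l, ε)) else 0)
      = 2 * (((ε : ℤ) : ℂ) ^ Parastatistics.deg l) * (if k = l then 1 else 0)
        * (if ε = -η then 1 else 0) := by
    by_cases h : conj (k, η) = (l, ε)
    · rw [if_pos h, ← h, rowCoeff_mul_colCoeff_conj]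
      obtain ⟨rfl, rfl⟩ := conj_eq_iff.1 h
      simp [conj]
    · rw [if_neg h]
      rw [conj_eq_iff, not_and_or] at h
      rcases h with h | h <;> simp [h]
  have ha : (if conj (j, ξ) = (l, ε) then
        2 * (superSign (par (j, ξ)) (par (k, η)) * (rowCoeff (j, ξ) * colCoeff (l, ε))) else 0)
      = -(-2 * (if j = l then 1 else 0) * (if ε = -ξ then 1 else 0)
        * (((ε : ℤ) : ℂ) ^ Parastatistics.deg l)
        * (-1) ^ (Parastatistics.deg k * Parastatistics.deg l)) := by
    by_cases h : conj (j, ξ) = (l, ε)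
    · rw [if_pos h, ← h, rowCoeff_mul_colCoeff_conj, superSign_par]
      obtain ⟨rfl, rfl⟩ := conj_eq_iff.1 h
      simp only [conj, mul_comm (Parastatistics.deg j), if_true]
      ring
    · rw [if_neg h]
      rw [conj_eq_iff, not_and_or] at h
      rcases h with h | h <;> simp [h]
  rw [ha, hb, neg_smul, sub_neg_eq_add, add_comm]
  rfl

/-! ### Generation of `B(∞,∞)` -/

/-- An element of `B(∞,∞)` is fixed by the symmetrization that its block conditions express, so
twice the element is a combination of symmetrized matrix units. -/
theorem two_smul_eq_sum {X : FinMat} (hX : Mem X) {s : Finset ℤ}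
    (hs : ∀ i j, X.1 i j ≠ 0 → i ∈ s ∧ j ∈ s) :
    (2 : ℂ) • X = ∑ k ∈ s, ∑ l ∈ s, X.1 k l • (e k l -
      (tsign (idx k) (idx l) * beta (partner k) * beta (partner l)) •
        e (partner l) (partner k)) := by
  have hsum : ∀ (w : ℤ → ℤ → FinMat) (i j : ℤ), (∑ k ∈ s, ∑ l ∈ s, w k l).1 i j
      = ∑ k ∈ s, ∑ l ∈ s, (w k l).1 i j := by
    intro w i j
    simp [Matrix.sum_apply]
  have hpartner : ∀ k m, partner k = m ↔ k = partner m := fun k m =>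
    ⟨fun h => by rw [← h, partner_partner], fun h => by rw [h, partner_partner]⟩
  -- outside `s × s` the entries of `X` vanish, so the sum over `s × s` picks out any entry
  have hdelta : ∀ i j : ℤ, ∑ k ∈ s, ∑ l ∈ s, (if k = i then if l = j then X.1 k l else 0 else 0)
      = X.1 i j := by
    intro i j
    simp only [Finset.sum_ite_irrel, Finset.sum_const_zero, Finset.sum_ite_eq']
    have := hs i j
    grind
  rw [mem_iff] at hX
  ext i j
  have h1 := hdelta i j
  have h2 := hdelta (partner j) (partner i)
  have h3 := hX j i
  have hterm : ∀ k l, (X.1 k l • (e k l - (tsign (idx k) (idx l) * beta (partner k) *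
        beta (partner l)) • e (partner l) (partner k))).1 i j
      = (if k = i then if l = j then X.1 k l else 0 else 0)
        - (tsign (idx j) (idx i) * beta j * beta i) *
          (if k = partner j then if l = partner i then X.1 k l else 0 else 0) := by
    intro k l
    simp only [FinMat.smul_apply, sub_apply, e_apply, hpartner, mul_sub]
    congr 1
    · split_ifs <;> simp_all
    · by_cases hk : k = partner j <;> by_cases hl : l = partner i
      · subst hk hl
        simp only [partner_partner, idx_partner, and_self, if_true]
        ring
      all_goals simp [hk, hl]
  have ht : tsign (idx j) (idx i) * tsign (idx j) (idx i) = 1 := by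
    unfold tsign; split_ifs <;> norm_num
  rw [hsum, FinMat.smul_apply]
  simp only [hterm, Finset.sum_sub_distrib, ← Finset.mul_sum, h1, h2]
  rw [h3]
  linear_combination (-X.1 i j) * ((beta j * beta j) * (beta i * beta i) * ht
    + (beta i * beta i) * beta_mul_self j + beta_mul_self i)

/-- The sign of the super transpose in terms of the signs of the superbracket. -/
theorem tsign_eq (p q : ZMod 2) : tsign p q = superSign p q * superSign q q := by
  have h2 : ∀ z : ZMod 2, z = 0 ∨ z = 1 := by decide
  rcases h2 p with rfl | rfl <;> rcases h2 q with rfl | rfl <;>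
    simp [tsign, superSign, ZMod.val_one]

/-- The coefficients of the invariant form are the relative signs of the two entries of the
generators, up to the sign `-1` for even generators. -/
theorem beta_row (a : Label) :
    beta (row a) = -(superSign (par a) (par a) * (colCoeff a * rowCoeff a)) := by
  obtain ⟨⟨i, hi⟩, ξ⟩ := a
  rcases lt_or_gt_of_ne hi with h | h <;> rcases Int.units_eq_one_or ξ with rfl | rfl
  · rw [beta, if_neg (by simp [row]; grind)]
    simp [par, Parastatistics.deg, superSign, colCoeff, rowCoeff, h.not_gt]
  · rw [beta, if_neg (by simp [row]; grind)]
    simp [par, Parastatistics.deg, superSign, colCoeff, rowCoeff, h.not_gt]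
  · rw [beta, if_neg (by simp [row, h])]
    simp [par, Parastatistics.deg, superSign, colCoeff, rowCoeff, h, ZMod.val_one]
  · rw [beta, if_pos (by simp [row, h])]
    simp [par, Parastatistics.deg, superSign, colCoeff, rowCoeff, h, ZMod.val_one]

theorem sqrt_two_ne_zero : (Real.sqrt 2 : ℂ) ≠ 0 := fun h => by
  have := sqrt_two_mul_self
  rw [h] at this
  norm_num at this

/-- Each symmetrized matrix unit is zero or proportional to a generator or to a bracket of two
generators. -/
theorem symm_e_mem {S : Submodule ℂ FinMat} (h1 : ∀ a : Label, cMat a.1.1 a.2 ∈ S)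
    (h2 : ∀ a b : Label, superBracket (cMat a.1.1 a.2) (cMat b.1.1 b.2) ∈ S) (k l : ℤ) :
    e k l - (tsign (idx k) (idx l) * beta (partner k) * beta (partner l)) •
        e (partner l) (partner k) ∈ S := by
  have hrow : ∀ m : ℤ, m ≠ 0 → ∃ a, row (conj a) = m := fun m hm => by
    obtain ⟨a, ha⟩ := row_surjective hm
    exact ⟨conj a, by rw [conj_conj, ha]⟩
  have hr2 := sqrt_two_ne_zero
  by_cases hk : k = 0 <;> by_cases hl : l = 0
  · subst hk hl
    simp [vals_zero, tsign]
  · subst hk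
    obtain ⟨b, rfl⟩ := hrow l hl
    convert S.smul_mem (rowCoeff b / Real.sqrt 2) (h1 b) using 1
    have hs := superSign_mul_self (par b) (par b)
    have hs0 : superSign 0 (par b) = 1 := by simp [superSign]
    have hr := rowCoeff_mul_self b
    rw [cMat_eq, partner_row, conj_conj, idx_row, par_conj, beta_row, vals_zero.1, vals_zero.2.1,
      vals_zero.2.2, tsign_eq, hs0]
    match_scalars
    · field_simp
      linear_combination -hr
    · field_simp
      linear_combination (colCoeff b * rowCoeff b) * hs
  · subst hl
    obtain ⟨a, rfl⟩ := row_surjective hk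
    convert S.smul_mem (colCoeff a / Real.sqrt 2) (h1 a) using 1
    have hs := superSign_mul_self (par a) (par a)
    have hs0 : superSign (par a) 0 = 1 := by simp [superSign]
    have hs00 : superSign 0 0 = 1 := by simp [superSign]
    have hc := colCoeff_mul_self a
    rw [cMat_eq, partner_row, idx_row, beta_row, par_conj, colCoeff_conj, rowCoeff_conj,
      vals_zero.1, vals_zero.2.1, vals_zero.2.2, tsign_eq, hs0, hs00]
    match_scalars
    · field_simp
      linear_combination -hc
    · field_simp
      linear_combination (colCoeff a * rowCoeff a) * hs
  · obtain ⟨a, rfl⟩ := row_surjective hk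
    obtain ⟨b, rfl⟩ := hrow l hl
    convert S.smul_mem (colCoeff a * rowCoeff b / 2) (h2 a b) using 1
    have ha := superSign_mul_self (par a) (par a)
    have hb := superSign_mul_self (par b) (par b)
    have hc := colCoeff_mul_self a
    have hr := rowCoeff_mul_self b
    rw [superBracket_cMat, partner_row, partner_row, conj_conj, idx_row, idx_row, beta_row,
      beta_row, par_conj, par_conj, colCoeff_conj, rowCoeff_conj, tsign_eq]
    match_scalars
    · field_simp
      linear_combination (-(rowCoeff b * rowCoeff b)) * hc - hr
    · field_simp
      linear_combination (-(superSign (par a) (par b) * colCoeff a * rowCoeff a * colCoeff b *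
        rowCoeff b)) * (superSign (par b) (par b) * superSign (par b) (par b) * ha + hb)

/-- The matrices `c_i^ξ` generate `B(∞,∞)`. -/
theorem eq_top_of_c_mem {S : Submodule ℂ BInfty} (hc : ∀ i ξ, c i ξ ∈ S)
    (hsbr : ∀ x ∈ S, ∀ y ∈ S, sbr x y ∈ S) : S = ⊤ := by
  rw [eq_top_iff]
  rintro X -
  obtain ⟨s, hs⟩ := exists_bound X.1
  have hmem : X.1 ∈ S.map carrier.subtype := by
    rw [← (S.map carrier.subtype).smul_mem_iff (two_ne_zero (α := ℂ)), two_smul_eq_sum X.2 hs]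
    refine sum_mem fun k _ => sum_mem fun l _ => Submodule.smul_mem _ _ ?_
    exact symm_e_mem (fun a => Submodule.mem_map_of_mem (hc a.1 a.2))
      (fun a b => Submodule.mem_map_of_mem (hsbr _ (hc a.1 a.2) _ (hc b.1 b.2))) k l
  obtain ⟨Y, hY, hYX⟩ := hmem
  rwa [← Subtype.ext hYX]

end BInfty

/-! ### Algebras with the triple relations -/

namespace Parastatistics

open BInfty FinMat Label

variable {L : Type*} [AddCommGroup L] [Module ℂ L] [LieSuperalgebra L]

/-- Elements of a Lie superalgebra with the parities of the generators that satisfy the triple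
relations. -/
structure IsTripleFamily (f : ZStar → ℤˣ → L) : Prop where
  mem_grade : ∀ i ξ, f i ξ ∈ (LieSuperalgebra.grade (deg i : ZMod 2) : Submodule ℂ L)
  triple : ∀ j k l ξ η ε, sbr (sbr (f j ξ) (f k η)) (f l ε) = tripleRHS f j k l ξ η ε

/-- The span of a family of elements and of their brackets. -/
def quadraticSpan (f : ZStar → ℤˣ → L) : Submodule ℂ L :=
  Submodule.span ℂ (Set.range (fun a : Label => f a.1 a.2) ∪
    Set.range fun p : Label × Label => sbr (f p.1.1 p.1.2) (f p.2.1 p.2.2))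

theorem mem_quadraticSpan (f : ZStar → ℤˣ → L) (i : ZStar) (ξ : ℤˣ) : f i ξ ∈ quadraticSpan f :=
  Submodule.subset_span (Or.inl ⟨(i, ξ), rfl⟩)

theorem sbr_mem_quadraticSpan (f : ZStar → ℤˣ → L) (i j : ZStar) (ξ η : ℤˣ) :
    sbr (f i ξ) (f j η) ∈ quadraticSpan f :=
  Submodule.subset_span (Or.inr ⟨((i, ξ), (j, η)), rfl⟩)

/-- By the triple relations and the Jacobi identity, brackets of any length reduce to combinations
of generators and of brackets of two generators. -/
theorem IsTripleFamily.sbr_mem {f : ZStar → ℤˣ → L} (hf : IsTripleFamily f) {x y : L}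
    (hx : x ∈ quadraticSpan f) (hy : y ∈ quadraticSpan f) : sbr x y ∈ quadraticSpan f := by
  have hle : Submodule.map₂ LieSuperalgebra.sbr (quadraticSpan f) (quadraticSpan f)
      ≤ quadraticSpan f := by
    conv_lhs => rw [quadraticSpan, Submodule.map₂_span_span]
    rw [Submodule.span_le, Set.image2_subset_iff]
    rintro _ (⟨⟨i, ξ⟩, rfl⟩ | ⟨⟨⟨i, ξ⟩, ⟨j, η⟩⟩, rfl⟩) _ (⟨⟨k, ε⟩, rfl⟩ | ⟨⟨⟨k, ε⟩, ⟨l, ζ⟩⟩, rfl⟩)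
    · exact sbr_mem_quadraticSpan f _ _ _ _
    · change sbr (f i ξ) (sbr (f k ε) (f l ζ)) ∈ quadraticSpan f
      have hskew : sbr (f i ξ) (sbr (f k ε) (f l ζ)) = -(_ • sbr (sbr (f k ε) (f l ζ)) (f i ξ)) :=
        LieSuperalgebra.skew (hf.mem_grade i ξ)
          (LieSuperalgebra.sbr_mem (hf.mem_grade k ε) (hf.mem_grade l ζ))
      rw [hskew, hf.triple]
      exact neg_mem (Submodule.smul_mem _ _ (add_mem
        (Submodule.smul_mem _ _ (mem_quadraticSpan f _ _))
        (Submodule.smul_mem _ _ (mem_quadraticSpan f _ _))))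
    · change sbr (sbr (f i ξ) (f j η)) (f k ε) ∈ quadraticSpan f
      rw [hf.triple]
      exact add_mem (Submodule.smul_mem _ _ (mem_quadraticSpan f _ _))
        (Submodule.smul_mem _ _ (mem_quadraticSpan f _ _))
    · change sbr (sbr (f i ξ) (f j η)) (sbr (f k ε) (f l ζ)) ∈ quadraticSpan f
      have hjacobi : sbr (sbr (f i ξ) (f j η)) (sbr (f k ε) (f l ζ))
          = sbr (sbr (sbr (f i ξ) (f j η)) (f k ε)) (f l ζ)
            + _ • sbr (f k ε) (sbr (sbr (f i ξ) (f j η)) (f l ζ)) :=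
        LieSuperalgebra.jacobi (LieSuperalgebra.sbr_mem (hf.mem_grade i ξ) (hf.mem_grade j η))
          (hf.mem_grade k ε) (hf.mem_grade l ζ)
      rw [hjacobi, hf.triple, hf.triple]
      simp only [tripleRHS, sbr, map_add, map_smul, LinearMap.add_apply, LinearMap.smul_apply]
      have h := sbr_mem_quadraticSpan f
      exact add_mem (add_mem (Submodule.smul_mem _ _ (h _ _ _ _))
        (Submodule.smul_mem _ _ (h _ _ _ _)))
        (Submodule.smul_mem _ _ (add_mem (Submodule.smul_mem _ _ (h _ _ _ _))
          (Submodule.smul_mem _ _ (h _ _ _ _))))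
  exact hle (Submodule.apply_mem_map₂ _ hx hy)

/-! ### Recovering an element from its matrix -/

/-- The entries of a finitary matrix, as a finitely supported function. -/
def entries : FinMat →ₗ[ℂ] (ℤ × ℤ →₀ ℂ) where
  toFun X := Finsupp.ofSupportFinite (fun p => X.1 p.1 p.2) X.2
  map_add' X Y := by ext p; rfl
  map_smul' c X := by ext p; rfl

theorem entries_e (i j : ℤ) : entries (e i j) = Finsupp.single (i, j) 1 := by
  ext ⟨k, l⟩
  simp only [Finsupp.single_apply, Prod.mk.injEq]
  exact e_apply i j k l

theorem lcomapDomain_single {α β : Type*} {g : α → β} (hg : Function.Injective g) (a : α) :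
    Finsupp.lcomapDomain (R := ℂ) g hg (Finsupp.single (g a) (1 : ℂ)) = Finsupp.single a 1 := by
  ext b
  simp [Finsupp.lcomapDomain]

theorem lcomapDomain_single_of_ne {α β : Type*} {g : α → β} (hg : Function.Injective g) {b : β}
    (hb : ∀ a, b ≠ g a) : Finsupp.lcomapDomain (R := ℂ) g hg (Finsupp.single b (1 : ℂ)) = 0 := by
  ext a
  simp [Finsupp.lcomapDomain, hb a]

theorem colPosition_injective : Function.Injective fun a : Label => (row a, (0 : ℤ)) :=
  fun _ _ h => row_injective (congrArg Prod.fst h)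

theorem pairPosition_injective :
    Function.Injective fun p : Label × Label => (row p.1, row (conj p.2)) := fun _ _ h =>
  Prod.ext (row_injective (congrArg Prod.fst h))
    (conj_injective (row_injective (congrArg Prod.snd h)))

/-- The linear map that reads off an element from its matrix: the entries in column `0` are the
coordinates for the generators, and the entries outside row and column `0` those for the brackets of
two generators. The matrix of `⟦c_a, c_b⟧` carries the factor `2`, and it contributes equally
through its entries at the places of `(a, b)` and of `(b, a)`; whence the factor `1 / 4`. -/
def reconstruct (f : ZStar → ℤˣ → L) : FinMat →ₗ[ℂ] L :=
  (Finsupp.linearCombination ℂ fun a : Label => (colCoeff a / Real.sqrt 2) • f a.1 a.2) ∘ₗ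
      Finsupp.lcomapDomain _ colPosition_injective ∘ₗ entries
    + (Finsupp.linearCombination ℂ fun p : Label × Label =>
        (colCoeff p.1 * rowCoeff p.2 / 4) • sbr (f p.1.1 p.1.2) (f p.2.1 p.2.2)) ∘ₗ
      Finsupp.lcomapDomain _ pairPosition_injective ∘ₗ entries

theorem reconstruct_e_col (f : ZStar → ℤˣ → L) (a : Label) :
    reconstruct f (e (row a) 0) = (colCoeff a / Real.sqrt 2) • f a.1 a.2 := by
  simp only [reconstruct, LinearMap.add_apply, LinearMap.comp_apply, entries_e]
  rw [lcomapDomain_single colPosition_injective a, lcomapDomain_single_of_ne pairPosition_injective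
    (fun p h => row_ne_zero _ (congrArg Prod.snd h).symm)]
  simp

theorem reconstruct_e_row (f : ZStar → ℤˣ → L) (k : ℤ) : reconstruct f (e 0 k) = 0 := by
  simp only [reconstruct, LinearMap.add_apply, LinearMap.comp_apply, entries_e]
  rw [lcomapDomain_single_of_ne colPosition_injective
      (fun a h => row_ne_zero _ (congrArg Prod.fst h).symm),
    lcomapDomain_single_of_ne pairPosition_injective
      (fun p h => row_ne_zero _ (congrArg Prod.fst h).symm)]
  simp

theorem reconstruct_e_pair (f : ZStar → ℤˣ → L) (a b : Label) :
    reconstruct f (e (row a) (row (conj b)))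
      = (colCoeff a * rowCoeff b / 4) • sbr (f a.1 a.2) (f b.1 b.2) := by
  simp only [reconstruct, LinearMap.add_apply, LinearMap.comp_apply, entries_e]
  rw [lcomapDomain_single pairPosition_injective (a, b), lcomapDomain_single_of_ne
    colPosition_injective (fun p h => row_ne_zero _ (congrArg Prod.snd h))]
  simp

theorem reconstruct_cMat (f : ZStar → ℤˣ → L) (a : Label) :
    reconstruct f (cMat a.1.1 a.2) = f a.1 a.2 := by
  have hr2 := sqrt_two_ne_zero
  have hc := colCoeff_mul_self a
  rw [cMat_eq, map_smul, map_add, map_smul, map_smul, reconstruct_e_col, reconstruct_e_row]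
  match_scalars
  field_simp
  linear_combination hc

theorem reconstruct_superBracket {f : ZStar → ℤˣ → L} (hf : IsTripleFamily f) (a b : Label) :
    reconstruct f (superBracket (cMat a.1.1 a.2) (cMat b.1.1 b.2))
      = sbr (f a.1 a.2) (f b.1 b.2) := by
  have hskew : sbr (f a.1 a.2) (f b.1 b.2)
      = -(superSign (par a) (par b) • sbr (f b.1 b.2) (f a.1 a.2)) :=
    LieSuperalgebra.skew (hf.mem_grade a.1 a.2) (hf.mem_grade b.1 b.2)
  have h1 : colCoeff a * rowCoeff b * (colCoeff a * rowCoeff b / 4) = 1 / 4 := by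
    linear_combination (1 / 4 : ℂ) * rowCoeff b * rowCoeff b * colCoeff_mul_self a
      + (1 / 4 : ℂ) * rowCoeff_mul_self b
  have h2 : colCoeff b * rowCoeff a * (colCoeff b * rowCoeff a / 4) = 1 / 4 := by
    linear_combination (1 / 4 : ℂ) * rowCoeff a * rowCoeff a * colCoeff_mul_self b
      + (1 / 4 : ℂ) * rowCoeff_mul_self a
  rw [superBracket_cMat, map_smul, map_sub, map_smul, map_smul, reconstruct_e_pair,
    reconstruct_e_pair, smul_smul, mul_smul (superSign _ _), smul_smul (colCoeff b * rowCoeff a),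
    h1, h2]
  have hskew' : superSign (par a) (par b) • (1 / 4 : ℂ) • sbr (f b.1 b.2) (f a.1 a.2)
      = -((1 / 4 : ℂ) • sbr (f a.1 a.2) (f b.1 b.2)) := by
    rw [hskew, smul_neg, neg_neg, smul_comm]
  rw [hskew']
  module

/-! ### The presented algebra -/

/-- The triple relations hold in the presented algebra because they are its relators. -/
theorem isTripleFamily_gen : IsTripleFamily fun i ξ => presentation.gen (i, ξ) where
  mem_grade i ξ := presentation.gen_mem_grade (i, ξ)
  triple j k l ξ η ε := by
    have h := presentation.mkQ_eq_zero_of_mem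
      (show relator j k l ξ η ε ∈ presentation.relators from ⟨j, k, l, ξ, η, ε, rfl⟩)
    rw [relator, map_sub, sub_eq_zero] at h
    refine h.trans ?_
    rw [tripleRHS, map_add, map_smul, map_smul]
    rfl

/-- The presented algebra is spanned by its generators and their brackets. -/
theorem quadraticSpan_gen : quadraticSpan (fun i ξ => presentation.gen (i, ξ)) = ⊤ :=
  presentation.eq_top_of_gen_mem (fun x => mem_quadraticSpan _ x.1 x.2)
    fun _ hx _ hy => isTripleFamily_gen.sbr_mem hx hy

/-- Reading off the matrix entries is a left inverse of the homomorphism, as can be checked on the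
generators and their brackets. -/
theorem hom_injective (φ : LieSuperHom presentation.Algebra BInfty)
    (hφ : ∀ i ξ, φ.toLinearMap (presentation.gen (i, ξ)) = BInfty.c i ξ) :
    Function.Injective φ.toLinearMap := by
  have hle : quadraticSpan (fun i ξ => presentation.gen (i, ξ)) ≤ LinearMap.eqLocus
      ((reconstruct fun i ξ => presentation.gen (i, ξ)) ∘ₗ carrier.subtype ∘ₗ φ.toLinearMap)
      LinearMap.id := by
    refine Submodule.span_le.2 ?_
    rintro _ (⟨a, rfl⟩ | ⟨⟨a, b⟩, rfl⟩)
    · have h : φ.toLinearMap (presentation.gen a) = c a.1 a.2 := hφ a.1 a.2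
      exact (congrArg (fun X : BInfty =>
        reconstruct (fun i ξ => presentation.gen (i, ξ)) X.1) h).trans (reconstruct_cMat _ a)
    · have h : φ.toLinearMap (sbr (presentation.gen a) (presentation.gen b))
          = sbr (c a.1 a.2) (c b.1 b.2) := by
        rw [φ.map_sbr, ← hφ, ← hφ]
      exact (congrArg (fun X : BInfty =>
        reconstruct (fun i ξ => presentation.gen (i, ξ)) X.1) h).trans
        (reconstruct_superBracket isTripleFamily_gen a b)
  rw [quadraticSpan_gen] at hle
  exact Function.LeftInverse.injective
    (g := fun X : BInfty => reconstruct (fun i ξ => presentation.gen (i, ξ)) X.1)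
    fun x => hle (Submodule.mem_top (x := x))

theorem hom_surjective (φ : LieSuperHom presentation.Algebra BInfty)
    (hφ : ∀ i ξ, φ.toLinearMap (presentation.gen (i, ξ)) = BInfty.c i ξ) :
    Function.Surjective φ.toLinearMap := by
  refine LinearMap.range_eq_top.1 (eq_top_of_c_mem (fun i ξ => ⟨_, hφ i ξ⟩) ?_)
  rintro _ ⟨x, rfl⟩ _ ⟨y, rfl⟩
  exact ⟨sbr x y, φ.map_sbr x y⟩

theorem evalFree_c_relator {r : FreeSuper.Free (ZStar × ℤˣ)} (hr : r ∈ presentation.relators) :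
    SuperPresentation.evalFree (fun x : ZStar × ℤˣ => BInfty.c x.1 x.2) r = 0 := by
  obtain ⟨j, k, l, ξ, η, ε, rfl⟩ := hr
  simp only [relator, tripleRHS, letter, map_sub, map_add, map_smul,
    SuperPresentation.evalFree_mul, SuperPresentation.evalFree_of]
  exact sub_eq_zero.2 (c_triple j k l ξ η ε)

/-- The homomorphism from the presented algebra to `B(∞,∞)` that preserves the names of the
generators. -/
def toBInfty : LieSuperHom presentation.Algebra BInfty :=
  presentation.lift (fun x => BInfty.c x.1 x.2) (fun x => cMat_mem_homog x)
    fun _ hr => evalFree_c_relator hr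

theorem toBInfty_gen (x : ZStar × ℤˣ) :
    toBInfty.toLinearMap (presentation.gen x) = BInfty.c x.1 x.2 :=
  SuperPresentation.lift_gen _ _ _ _ x

end Parastatistics

end

theorem theorem11 :
    (∀ (j k l : ZStar) (ξ η ε : ℤˣ),
      sbr (sbr (BInfty.c j ξ) (BInfty.c k η)) (BInfty.c l ε)
        = Parastatistics.tripleRHS BInfty.c j k l ξ η ε) ∧
    (∀ S : Submodule ℂ BInfty, (∀ i ξ, BInfty.c i ξ ∈ S) → (∀ x ∈ S, ∀ y ∈ S, sbr x y ∈ S) →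
      S = ⊤) ∧
    (∃! φ : LieSuperHom Parastatistics.presentation.Algebra BInfty,
      ∀ i ξ, φ.toLinearMap (Parastatistics.presentation.gen (i, ξ)) = BInfty.c i ξ) ∧
    ∀ φ : LieSuperHom Parastatistics.presentation.Algebra BInfty,
      (∀ i ξ, φ.toLinearMap (Parastatistics.presentation.gen (i, ξ)) = BInfty.c i ξ) →
        Function.Bijective φ.toLinearMap := by
  refine ⟨BInfty.c_triple, fun S hc hsbr => BInfty.eq_top_of_c_mem hc hsbr, ?_,
    fun φ hφ => ⟨Parastatistics.hom_injective φ hφ, Parastatistics.hom_surjective φ hφ⟩⟩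
  refine ⟨Parastatistics.toBInfty, fun i ξ => Parastatistics.toBInfty_gen (i, ξ), fun ψ hψ => ?_⟩
  exact Parastatistics.presentation.hom_ext fun x =>
    (hψ x.1 x.2).trans (Parastatistics.toBInfty_gen x).symm
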